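/- **Setting.** Let $\mathbb{R}^n=\mathbb{R}^{n_1}\times\dots\times\mathbb{R}^{n_K}$ and $\Omega=\Omega_1\times\dots\times\Omega_K$, where $\Omega_k=\{u\in\mathbb{R}^{n_k}:\langle\omega_{k,i},u\rangle\le h_{k,i},\ i=1,\dots,m_k\}$ are non-empty polyhedra. Let $\mathcal{A}_{\Omega_k}(u)$ be the set of indices $i$ with $\langle\omega_{k,i},u\rangle=h_{k,i}$ and $\mathcal{A}_\Omega(x)=\{(k,i): i\in\mathcal{A}_{\Omega_k}(x_k)\}$. Let $\mathcal{N}_\Omega(x)=\{v:\langle v,y-x\rangle\le0\ \forall y\in\Omega\}$ be the normal cone, $\mathcal{T}_\Omega(x)$ the tangent cone (closure of the feasible directions at $x$), $P_C$ the Euclidean projection onto a closed convex set $C$, and $\nabla_\Omega L(x)=P_{\mathcal{T}_\Omega(x)}(-\nabla L(x))$. For each $x\in\Omega$ let $B(x)$ be a symmetric matrix and $$m(w)=L(x)+\langle\nabla L(x),w-x\rangle+\tfrac12\langle w-x,B(x)(w-x)\rangle$$ the model of $L$ around $x$. **Algorithm.** Fix constants $0<\sigma_1<\sigma_2<1<\sigma_3$,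 $0<\eta_1<\eta_2<1$, $\gamma_1\in(0,1)$, $\gamma_2>0$, $\nu_0\in(0,1)$, $0<\nu_1<\nu_2$, $\nu_3,\nu_4,\nu_5>0$ and $0<\underline\sigma<\bar\sigma$. Start from $x^0\in\Omega$, $\Delta^0>0$. Given the iterate $x=x^l$ and the radius $\Delta=\Delta^l$, with $m$ the model around $x$: 1. *(Cauchy point $z=z^l$.)* For $k=1,\dots,K$ in turn let $m_k(v)=m(z_1,\dots,z_{k-1},v,x_{k+1},\dots,x_K)$, $z_k(a)=P_{\Omega_k}(x_k-a\nabla m_k(x_k))$ and $z_k=z_k(\alpha_k)$, where $\alpha_k$ is any step-size such that $m_k(z_k)\le m_k(x_k)+\nu_0\langle\nabla m_k(x_k),z_k-x_k\rangle$, $\|z_k-x_k\|_\infty\le\nu_2\Delta$, and either $\alpha_k\in[\nu_4,\nu_5]$, or $\alpha_k\in[\nu_3\bar\alpha_k,\nu_5]$ for some $\bar\alpha_k>0$ with $m_k(z_k(\bar\alpha_k))>m_k(x_k)+\nu_0\langle\nabla m_k(x_k),z_k(\bar\alpha_k)-x_k\rangle$ or $\|z_k(\bar\alpha_k)-x_k\|_\infty\ge\nu_1\Delta$.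 2. *(Refinement.)* Choose any $y=y^l\in\Omega$ with $m(x)-m(y)\ge\gamma_1(m(x)-m(z))$, $\|y-x\|_\infty\le\gamma_2\Delta$, $\mathcal{A}_{\Omega_k}(z_k)\subseteq\mathcal{A}_{\Omega_k}(y_k)$ for all $k$, and $m(y)+\frac{\sigma^l}{2}\|y-z\|_2^2\le m(z)$ for some $\sigma^l\in(\underline\sigma,\bar\sigma)$ (so $y$ does not increase the regularised model $m(\cdot)+\frac{\sigma^l}{2}\|\cdot-z\|_2^2$ from its value at $z$). 3. *(Update.)* Let $\rho=\frac{L(x)-L(y)}{m(x)-m(y)}$ (with $\rho=0$ if the denominator vanishes, which happens only if $y=z=x$). If $\rho<\eta_1$, then $x^{l+1}=x$ and $\Delta^{l+1}\in[\sigma_1\Delta,\sigma_2\Delta]$. If $\rho\in[\eta_1,\eta_2]$, then $x^{l+1}=y$ and $\Delta^{l+1}\in[\sigma_1\Delta,\sigma_3\Delta]$. If $\rho>\eta_2$, then $x^{l+1}=y$ and $\Delta^{l+1}\in[\Delta,\sigma_3\Delta]$. **Theorem (finite active-set identification).** Let $(x^l)$, $(z^l)$ be infinite sequences of iterates and Cauchy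 points generated in this way. Assume that * $L$ is bounded below on $\{x\in\Omega: L(x)\le L(x^0)\}$; * $L$ is continuously differentiable on an open set containing $\Omega$, and $\nabla L$ is uniformly continuous on $\Omega$; * there is $\hat B>0$ with $\|B(x)\|_2\le\hat B$ for all $x\in\Omega$; * $(x^l)$ has a limit point $x^\ast$ that is non-degenerate, i.e. $-\nabla L(x^\ast)\in\operatorname{ri}(\mathcal{N}_\Omega(x^\ast))$, $\nabla L$ is differentiable at $x^\ast$, and for some $\kappa>0$ one has $\langle v,\nabla^2L(x^\ast)v\rangle\ge\kappa\|v\|_2^2$ for all $v$ orthogonal to $\mathcal{N}_\Omega(x^\ast)$. Then $\lim_{l\to\infty}\|\nabla_\Omega L(x^l)\|_2=0$, and there is $l_0$ such that for all $l\ge l_0$ $$\mathcal{A}_\Omega(x^l)=\mathcal{A}_\Omega(x^\ast)\quad\text{and}\quad\mathcal{A}_\Omega(z^l)=\mathcal{A}_\Omega(x^\ast).$$ -/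

import Mathlib

open Filter Topology

namespace TRAP

noncomputable section

/-! ### Convex-analytic notions -/

section Convex

variable {F : Type*} [NormedAddCommGroup F] [InnerProductSpace ℝ F]

/-- `p` is a point of `C` closest to `u`. -/
def IsClosestPoint (C : Set F) (u p : F) : Prop :=
  p ∈ C ∧ ∀ q ∈ C, ‖u - p‖ ≤ ‖u - q‖

/-- The projection `P_C(u)` onto a nonempty closed convex set `C`
(see `proj_spec` and `proj_eq`). -/
def proj (C : Set F) (u : F) : F :=
  Classical.epsilon (IsClosestPoint C u)

theorem proj_spec [CompleteSpace F] {C : Set F} (hne : C.Nonempty) (hcl : IsClosed C)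
    (hcv : Convex ℝ C) (u : F) : IsClosestPoint C u (proj C u) := by
  apply Classical.epsilon_spec (p := IsClosestPoint C u)
  obtain ⟨v, hv, hmin⟩ := exists_norm_eq_iInf_of_complete_convex hne hcl.isComplete hcv u
  refine ⟨v, hv, fun q hq => ?_⟩
  rw [hmin]
  exact ciInf_le ⟨0, Set.forall_mem_range.2 fun _ => norm_nonneg _⟩ (⟨q, hq⟩ : C)

theorem proj_eq [CompleteSpace F] {C : Set F} (hcl : IsClosed C) (hcv : Convex ℝ C) {u p : F}
    (hp : IsClosestPoint C u p) : proj C u = p := by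
  have key : ∀ {r : F}, IsClosestPoint C u r → ∀ w ∈ C, inner ℝ (u - r) (w - r) ≤ 0 := by
    intro r hr
    rw [← norm_eq_iInf_iff_real_inner_le_zero hcv hr.1]
    have : Nonempty C := ⟨⟨r, hr.1⟩⟩
    exact le_antisymm (le_ciInf fun w => hr.2 w w.2)
      (ciInf_le ⟨0, Set.forall_mem_range.2 fun _ => norm_nonneg _⟩ (⟨r, hr.1⟩ : C))
  have hq := proj_spec ⟨p, hp.1⟩ hcl hcv u
  have h1 := key hp _ hq.1
  have h2 := key hq _ hp.1
  have h3 : inner ℝ (proj C u - p) (proj C u - p) ≤ 0 := by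
    have e : proj C u - p = (u - p) - (u - proj C u) := by abel
    have e' : p - proj C u = -(proj C u - p) := by abel
    rw [e', inner_neg_right] at h2
    nth_rewrite 1 [e]
    rw [inner_sub_left]
    linarith
  exact sub_eq_zero.1 (inner_self_eq_zero.1 (le_antisymm h3 real_inner_self_nonneg))

/-- The normal cone to `Ω` at `x ∈ Ω`. -/
def normalCone (Ω : Set F) (x : F) : Set F :=
  {v | ∀ y ∈ Ω, inner ℝ v (y - x) ≤ 0}

/-- The tangent cone to `Ω` at `x ∈ Ω`: the closure of the set of feasible directions. -/
def tangentCone (Ω : Set F) (x : F) : Set F :=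
  closure {d | ∃ t : ℝ, 0 < t ∧ x + t • d ∈ Ω}

variable [CompleteSpace F]

/-- The projected gradient `∇_Ω L(x) = P_{T_Ω(x)}(-∇L(x))`. -/
def projGrad (Ω : Set F) (L : F → ℝ) (x : F) : F :=
  proj (tangentCone Ω x) (-gradient L x)

/-- Non-degeneracy of a critical point: `-∇L(x)` lies in the relative interior of the normal
cone (in particular in the normal cone itself, so that `x` is critical). -/
def NonDegenerate (Ω : Set F) (L : F → ℝ) (x : F) : Prop :=
  -gradient L x ∈ intrinsicInterior ℝ (normalCone Ω x)

/-- `⟨v, H(x) v⟩ ≥ κ ‖v‖²` on the orthogonal complement of the normal cone, where the Hessian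
`H(x)` is the derivative at `x` of the gradient, which is required to exist. -/
def StrongSecondOrder (Ω : Set F) (L : F → ℝ) (x : F) (κ : ℝ) : Prop :=
  DifferentiableAt ℝ (gradient L) x ∧
    ∀ v : F, (∀ w ∈ normalCone Ω x, inner ℝ w v = 0) →
      κ * ‖v‖ ^ 2 ≤ inner ℝ v (fderiv ℝ (gradient L) x v)

/-- The quadratic model of `L` around `x` with model Hessian `B x`. -/
def model (L : F → ℝ) (B : F → F →L[ℝ] F) (x w : F) : ℝ :=
  L x + inner ℝ (gradient L x) (w - x) + (1 / 2) * inner ℝ (w - x) (B x (w - x))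

end Convex

/-! ### Block variables and polyhedral constraints -/

/-- `ℝ^d` with its Euclidean structure. -/
abbrev Block (d : ℕ) : Type := EuclideanSpace ℝ (Fin d)

/-- `ℝ^{n_1} × ⋯ × ℝ^{n_K}` with its Euclidean structure. -/
abbrev Space {K : ℕ} (n : Fin K → ℕ) : Type := PiLp 2 fun k => Block (n k)

/-- The sup norm on one block. -/
def blockSupNorm {d : ℕ} (v : Block d) : ℝ := ‖(WithLp.ofLp v : Fin d → ℝ)‖

/-- The sup norm on the product: the largest modulus of a coordinate. -/
def supNorm {K : ℕ} {n : Fin K → ℕ} (v : Space n) : ℝ :=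
  ‖(fun k => WithLp.ofLp (v k) : ∀ k, Fin (n k) → ℝ)‖

/-- Finitely many linear inequalities `⟨ω k i, x_k⟩ ≤ h k i` on every block `k`. -/
structure Constraints {K : ℕ} (n : Fin K → ℕ) where
  /-- number of inequalities on block `k` -/
  m : Fin K → ℕ
  /-- normal vectors -/
  ω : ∀ k, Fin (m k) → Block (n k)
  /-- right-hand sides -/
  h : ∀ k, Fin (m k) → ℝ

namespace Constraints

variable {K : ℕ} {n : Fin K → ℕ} (P : Constraints n)

/-- The polyhedron `Ω_k`. -/
def blockSet (k : Fin K) : Set (Block (n k)) :=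
  {u | ∀ i, inner ℝ (P.ω k i) u ≤ P.h k i}

/-- `Ω = Ω_1 × ⋯ × Ω_K`. -/
def feasible : Set (Space n) :=
  {x | ∀ k, x k ∈ P.blockSet k}

/-- Indices of the inequalities of `Ω_k` that are active at `u`. -/
def blockActive (k : Fin K) (u : Block (n k)) : Set (Fin (P.m k)) :=
  {i | inner ℝ (P.ω k i) u = P.h k i}

/-- Indices (block, inequality) of the inequalities of `Ω` that are active at `x`. -/
def active (x : Space n) : Set (Σ k, Fin (P.m k)) :=
  {p | p.2 ∈ P.blockActive p.1 (x p.1)}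

end Constraints

/-- The point `(z_1, …, z_{k-1}, v, x_{k+1}, …, x_K)`. -/
def sweep {K : ℕ} {n : Fin K → ℕ} (z x : Space n) (k : Fin K) (v : Block (n k)) : Space n :=
  WithLp.toLp 2 (Function.update (fun j => if j < k then z j else x j) k v)

/-! ### The trust region algorithm with alternating projections -/

/-- Parameters of the algorithm. -/
structure Params where
  /-- radius update factors -/
  (σ₁ σ₂ σ₃ : ℝ)
  /-- test ratios -/
  (η₁ η₂ : ℝ)
  /-- refinement coefficients -/
  (γ₁ γ₂ : ℝ)
  /-- step-size coefficients -/
  (ν₀ ν₁ ν₂ ν₃ ν₄ ν₅ : ℝ)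
  /-- bounds on the regularisation coefficient -/
  (regLo regHi : ℝ)
  hσ : 0 < σ₁ ∧ σ₁ < σ₂ ∧ σ₂ < 1 ∧ 1 < σ₃
  hη : 0 < η₁ ∧ η₁ < η₂ ∧ η₂ < 1
  hγ : 0 < γ₁ ∧ γ₁ < 1 ∧ 0 < γ₂
  hν₀ : 0 < ν₀ ∧ ν₀ < 1
  hν₁₂ : 0 < ν₁ ∧ ν₁ < ν₂
  hν : 0 < ν₃ ∧ 0 < ν₄ ∧ 0 < ν₅
  hreg : 0 < regLo

section Algorithm

variable {K : ℕ} {n : Fin K → ℕ} (P : Constraints n) (L : Space n → ℝ)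
  (B : Space n → Space n →L[ℝ] Space n) (q : Params)

/-- The partial gradient `∇_k m(z_1, …, z_{k-1}, x_k, …, x_K)` of the model around `x`. -/
def sweepGrad (x z : Space n) (k : Fin K) : Block (n k) :=
  gradient (model L B x) (sweep z x k (x k)) k

/-- `z_k(a) = P_{Ω_k}(x_k - a ∇_k m(z_1, …, z_{k-1}, x_k, …, x_K))`. -/
def trialBlock (x z : Space n) (k : Fin K) (a : ℝ) : Block (n k) :=
  proj (P.blockSet k) (x k - a • sweepGrad L B x z k)

/-- Sufficient decrease of the model in block `k` at `v`, the blocks before `k` being those of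
`z` and the blocks after `k` those of `x`. -/
def SufficientDecrease (x z : Space n) (k : Fin K) (v : Block (n k)) : Prop :=
  model L B x (sweep z x k v) ≤
    model L B x (sweep z x k (x k)) + q.ν₀ * inner ℝ (sweepGrad L B x z k) (v - x k)

/-- `z` is a Cauchy point for the iterate `x` and the radius `Δ`, computed by one alternating
projected gradient sweep with step-sizes `α`. -/
def IsCauchyPoint (x : Space n) (Δ : ℝ) (α : Fin K → ℝ) (z : Space n) : Prop :=
  ∀ k,
    z k = trialBlock P L B x z k (α k) ∧
    SufficientDecrease L B q x z k (z k) ∧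
    blockSupNorm (z k - x k) ≤ q.ν₂ * Δ ∧
    (α k ∈ Set.Icc q.ν₄ q.ν₅ ∨
      ∃ a : ℝ, 0 < a ∧ α k ∈ Set.Icc (q.ν₃ * a) q.ν₅ ∧
        (¬ SufficientDecrease L B q x z k (trialBlock P L B x z k a) ∨
          q.ν₁ * Δ ≤ blockSupNorm (trialBlock P L B x z k a - x k)))

/-- `y` is an admissible outcome of the refinement phase started at the Cauchy point `z`: it is
feasible for the regularised problem of minimising `m(y) + (σ/2) ‖y - z‖²`, and the regularised
objective at `y` is not larger than at the starting point `z`, where it equals `m(z)`. -/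
def IsRefinement (x : Space n) (Δ σ : ℝ) (z y : Space n) : Prop :=
  y ∈ P.feasible ∧
  model L B x x - model L B x y ≥ q.γ₁ * (model L B x x - model L B x z) ∧
  supNorm (y - x) ≤ q.γ₂ * Δ ∧
  (∀ k, P.blockActive k (z k) ⊆ P.blockActive k (y k)) ∧
  model L B x y + σ / 2 * ‖y - z‖ ^ 2 ≤ model L B x z

/-- The ratio `ρ` of actual to predicted decrease.  A vanishing predicted decrease gives `ρ = 0`,
an unsuccessful iteration; for a refinement `y` this happens only if `y = z = x`. -/
def ratio (x y : Space n) : ℝ :=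
  (L x - L y) / (model L B x x - model L B x y)

/-- The trust region update `(x, Δ) ↦ (x', Δ')` after the refinement phase has produced `y`. -/
def IsUpdate (x : Space n) (Δ : ℝ) (y x' : Space n) (Δ' : ℝ) : Prop :=
  (ratio L B x y < q.η₁ → x' = x ∧ Δ' ∈ Set.Icc (q.σ₁ * Δ) (q.σ₂ * Δ)) ∧
  (ratio L B x y ∈ Set.Icc q.η₁ q.η₂ → x' = y ∧ Δ' ∈ Set.Icc (q.σ₁ * Δ) (q.σ₃ * Δ)) ∧
  (q.η₂ < ratio L B x y → x' = y ∧ Δ' ∈ Set.Icc Δ (q.σ₃ * Δ))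

/-- The sequences are generated by the algorithm, with iterates `x l`, Cauchy points `z l`,
refined points `y l`, radii `Δ l`, step-sizes `α l k` and regularisation coefficients `σ l`.
The loop body is repeated for ever (zero termination tolerance); a run that stops at a critical
point is covered by repeating that point, with `z l = y l = x l`. -/
structure IsRun (x z y : ℕ → Space n) (Δ σ : ℕ → ℝ) (α : ℕ → Fin K → ℝ) : Prop where
  init_mem : x 0 ∈ P.feasible
  init_radius : 0 < Δ 0
  reg : ∀ l, σ l ∈ Set.Ioo q.regLo q.regHi
  cauchy : ∀ l, IsCauchyPoint P L B q (x l) (Δ l) (α l) (z l)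
  refine : ∀ l, IsRefinement P L B q (x l) (Δ l) (σ l) (z l) (y l)
  update : ∀ l, IsUpdate L B q (x l) (Δ l) (y l) (x (l + 1)) (Δ (l + 1))

end Algorithm

end

end TRAP

/-!
The limit point `xs` is a strict local minimiser of `L` on `Ω`: by non-degeneracy `L` grows to first
order along every feasible direction that is not orthogonal to the normal cone, and by the
second-order condition it grows quadratically along the others
(`eventually_lt_of_strongSecondOrder`). The predicted decrease dominates `‖y - x‖²`, because the
projected sweep controls `‖z - x‖` and the regularisation controls `‖y - z‖`; so the steps tend to
zero, and a descent sequence with vanishing steps cannot leave the neighbourhood of a strict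
minimiser. Hence `x l → xs` (`IsRun.tendsto_iterates`), and since projected gradient steps are
nonexpansive and fix `xs`, also `z l → xs` and the partial gradients of the sweep converge
(`IsRun.tendsto_cauchy`, `IsRun.tendsto_sweepGrad`).

Identification is proved block by block. Write `v = -∇_k L(xs)`. The residual
`-g - (z_k - x_k) / α_k` of a projection step is normal at `z_k`. A polyhedron has finitely many
normal cones, all closed, and only those of points on the face of `xs` contain the relative
interior point `v`; so a residual close to `v` forces `z_k` onto that face
(`Constraints.exists_blockActive_subset`). If `x_k` is on the face already, then `v` is normal at
`x_k`, the step is at most `α_k ‖g + v‖` long, and the residual is close to `v` however small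
`α_k` is: the face is never left again (`IsRun.eventually_active_cauchy_of_active`).

It remains to see that the face is reached at all, although the step-sizes and radii might tend to
zero (`IsRun.frequently_active`). Let `δ = ⟨v, xs - x_k⟩` measure the distance from the face.
If `z_k` misses the face, then the step was limited by the radius, and both the predicted decrease
and `δ` are at least a multiple of `Δ`. If `z_k` hits the face, the predicted decrease is at least a
multiple of `δ`. Suppose that the face is never reached. Then accepted steps only start from
missing Cauchy points, each of them costs a multiple of `Δ` in the objective, and `Δ → 0`. For
small `Δ` the model error is `o(Δ)`, so misses are very successful and do not shrink the radius. A
rejected hit has `δ = o(Δ)`; as the iterate stays and the radius shrinks by a bounded factor, the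
next Cauchy point cannot miss, so it hits and is rejected again, and the iterates are constant and
equal to `xs`, which is on the face. Hence there are only misses in the end, and the radius does not
tend to zero.

On the face, `-∇L(xs)` is normal at `x l`, so the projected gradient is at most
`‖∇L(x l) - ∇L(xs)‖` long (`norm_projGrad_le`).
-/

namespace TRAP

/-! ### Normal cones -/

section NormalCone

variable {F : Type*} [NormedAddCommGroup F] [InnerProductSpace ℝ F]

theorem isClosed_normalCone (C : Set F) (x : F) : IsClosed (normalCone C x) := by
  have : normalCone C x = ⋂ y ∈ C, {v | inner ℝ v (y - x) ≤ 0} := by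
    ext v; simp [normalCone]
  rw [this]
  exact isClosed_biInter fun y _ => isClosed_le (by fun_prop) continuous_const

theorem zero_mem_normalCone (C : Set F) (x : F) : (0 : F) ∈ normalCone C x :=
  fun y _ => by simp

theorem smul_mem_normalCone {C : Set F} {x v : F} {t : ℝ} (ht : 0 ≤ t)
    (hv : v ∈ normalCone C x) : t • v ∈ normalCone C x := fun y hy => by
  rw [real_inner_smul_left]
  exact mul_nonpos_of_nonneg_of_nonpos ht (hv y hy)

/-- A normal vector at `x` is orthogonal to the segment from `x` to any feasible point at which
it is normal as well. -/
theorem inner_sub_eq_zero_of_mem_normalCone {C : Set F} {x z v : F} (hx : x ∈ C) (hz : z ∈ C)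
    (hvx : v ∈ normalCone C x) (hvz : v ∈ normalCone C z) : inner ℝ v (z - x) = 0 := by
  have h1 := hvx z hz
  have h2 := hvz x hx
  rw [← neg_sub, inner_neg_right] at h2
  linarith

end NormalCone

/-! ### Projections onto closed convex sets -/

section Projection

variable {F : Type*} [NormedAddCommGroup F] [InnerProductSpace ℝ F] [CompleteSpace F]

theorem proj_mem {C : Set F} (hne : C.Nonempty) (hcl : IsClosed C) (hcv : Convex ℝ C) (u : F) :
    proj C u ∈ C :=
  (proj_spec hne hcl hcv u).1

theorem proj_inner_le {C : Set F} (hne : C.Nonempty) (hcl : IsClosed C) (hcv : Convex ℝ C)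
    (u : F) {w : F} (hw : w ∈ C) : inner ℝ (u - proj C u) (w - proj C u) ≤ 0 := by
  have hr := proj_spec hne hcl hcv u
  refine (norm_eq_iInf_iff_real_inner_le_zero hcv hr.1).1 ?_ w hw
  have : Nonempty C := ⟨⟨_, hr.1⟩⟩
  exact le_antisymm (le_ciInf fun w => hr.2 w w.2)
    (ciInf_le ⟨0, Set.forall_mem_range.2 fun _ => norm_nonneg _⟩ (⟨_, hr.1⟩ : C))

theorem proj_eq_of_inner_le {C : Set F} (hcl : IsClosed C) (hcv : Convex ℝ C) {u p : F}
    (hp : p ∈ C) (h : ∀ w ∈ C, inner ℝ (u - p) (w - p) ≤ 0) : proj C u = p := by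
  refine proj_eq hcl hcv ⟨hp, fun q hq => ?_⟩
  have := (norm_eq_iInf_iff_real_inner_le_zero hcv hp).2 h
  rw [this]
  exact ciInf_le ⟨0, Set.forall_mem_range.2 fun _ => norm_nonneg _⟩ (⟨q, hq⟩ : C)

theorem norm_proj_sub_proj_le {C : Set F} (hne : C.Nonempty) (hcl : IsClosed C)
    (hcv : Convex ℝ C) (u v : F) : ‖proj C u - proj C v‖ ≤ ‖u - v‖ := by
  have h1 := proj_inner_le hne hcl hcv u (proj_mem hne hcl hcv v)
  have h2 := proj_inner_le hne hcl hcv v (proj_mem hne hcl hcv u)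
  set p := proj C u
  set r := proj C v
  have h3 : ‖p - r‖ ^ 2 ≤ inner ℝ (u - v) (p - r) := by
    rw [← real_inner_self_eq_norm_sq]
    have e : inner ℝ (p - r) (p - r) =
        inner ℝ (u - v) (p - r) + inner ℝ (u - p) (r - p) + inner ℝ (v - r) (p - r) := by
      simp only [inner_sub_left, inner_sub_right]; ring
    linarith
  have h4 := real_inner_le_norm (u - v) (p - r)
  by_contra! hlt
  nlinarith [norm_nonneg (u - v)]

theorem sub_proj_mem_normalCone {C : Set F} (hne : C.Nonempty) (hcl : IsClosed C)
    (hcv : Convex ℝ C) (u : F) : u - proj C u ∈ normalCone C (proj C u) :=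
  fun _ hw => proj_inner_le hne hcl hcv u hw

theorem proj_add_eq_of_mem_normalCone {C : Set F} (hcl : IsClosed C) (hcv : Convex ℝ C)
    {x v : F} (hx : x ∈ C) (hv : v ∈ normalCone C x) : proj C (x + v) = x :=
  proj_eq_of_inner_le hcl hcv hx fun w hw => by simpa using hv w hw

/-- The residual of a projection step, divided by the step-size, is a normal vector. -/
theorem residual_mem_normalCone {C : Set F} (hcl : IsClosed C) (hcv : Convex ℝ C) {x w : F}
    {a : ℝ} (hx : x ∈ C) (ha : 0 < a) :
    w - a⁻¹ • (proj C (x + a • w) - x) ∈ normalCone C (proj C (x + a • w)) := by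
  have h := smul_mem_normalCone (inv_nonneg.2 ha.le)
    (sub_proj_mem_normalCone ⟨x, hx⟩ hcl hcv (x + a • w))
  convert h using 1
  rw [add_sub_right_comm, smul_add, smul_smul, inv_mul_cancel₀ ha.ne', one_smul,
    ← neg_sub (proj C (x + a • w)) x, smul_neg]
  abel

theorem norm_sq_le_inner_proj {C : Set F} (hcl : IsClosed C) (hcv : Convex ℝ C) {x : F}
    (hx : x ∈ C) (w : F) (a : ℝ) :
    ‖proj C (x + a • w) - x‖ ^ 2 ≤ a * inner ℝ w (proj C (x + a • w) - x) := by
  have h := proj_inner_le ⟨x, hx⟩ hcl hcv (x + a • w) hx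
  set p := proj C (x + a • w)
  rw [← real_inner_self_eq_norm_sq, ← real_inner_smul_left]
  have e : inner ℝ (x + a • w - p) (x - p) = inner ℝ (p - x) (p - x) - inner ℝ (a • w) (p - x) := by
    simp only [inner_sub_left, inner_sub_right, inner_add_left]; ring
  linarith

/-- Step lengths along the projection arc: for two step-sizes `a` and `b`, either the step for
`a` is not longer than the step for `b`, or it is so by a factor of at most `a / b`. -/
theorem norm_proj_step_le_or {C : Set F} (hcl : IsClosed C) (hcv : Convex ℝ C) {x : F}
    (hx : x ∈ C) (w : F) {a b : ℝ} (ha : 0 < a) (hb : 0 < b) :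
    ‖proj C (x + a • w) - x‖ ≤ ‖proj C (x + b • w) - x‖ ∨
      b * ‖proj C (x + a • w) - x‖ ≤ a * ‖proj C (x + b • w) - x‖ := by
  have h1 := proj_inner_le ⟨x, hx⟩ hcl hcv (x + a • w) (proj_mem ⟨x, hx⟩ hcl hcv (x + b • w))
  have h2 := proj_inner_le ⟨x, hx⟩ hcl hcv (x + b • w) (proj_mem ⟨x, hx⟩ hcl hcv (x + a • w))
  set p := proj C (x + a • w) - x with hp
  set r := proj C (x + b • w) - x with hr
  have e1 : x + a • w - proj C (x + a • w) = a • w - p := by rw [hp]; abel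
  have e2 : x + b • w - proj C (x + b • w) = b • w - r := by rw [hr]; abel
  have e3 : proj C (x + b • w) - proj C (x + a • w) = r - p := by rw [hp, hr]; abel
  have e4 : proj C (x + a • w) - proj C (x + b • w) = p - r := by rw [hp, hr]; abel
  rw [e1, e3] at h1
  rw [e2, e4] at h2
  simp only [inner_sub_left, inner_sub_right, real_inner_smul_left,
    real_inner_self_eq_norm_sq, real_inner_comm p r] at h1 h2
  have h3 := mul_nonpos_of_nonneg_of_nonpos hb.le h1
  have h4 := mul_nonpos_of_nonneg_of_nonpos ha.le h2
  have h5 : a * ‖r‖ ^ 2 + b * ‖p‖ ^ 2 ≤ (a + b) * (‖r‖ * ‖p‖) := by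
    have h6 := mul_le_mul_of_nonneg_left (real_inner_le_norm r p) (add_pos ha hb).le
    have := real_inner_comm p r
    nlinarith
  by_contra! hc
  nlinarith [mul_pos (sub_pos.2 hc.1) (sub_pos.2 hc.2)]

end Projection

/-! ### Tangent cones -/

section Tangent

variable {F : Type*} [NormedAddCommGroup F] [InnerProductSpace ℝ F]

theorem convex_tangentCone {C : Set F} (hcv : Convex ℝ C) (x : F) :
    Convex ℝ (tangentCone C x) := by
  refine Convex.closure ?_
  rintro d ⟨s, hs, hd⟩ e ⟨t, ht, he⟩ a b ha hb hab
  have hst : 0 < a * t + b * s := by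
    rcases ha.eq_or_lt with rfl | ha'
    · have : b = 1 := by linarith
      subst this; simpa using hs
    · have := mul_pos ha' ht
      have := mul_nonneg hb hs.le
      linarith
  -- with `1 / r = a / s + b / t` the step `r` along `a d + b e` ends between the two points
  refine ⟨s * t / (a * t + b * s), by positivity, ?_⟩
  convert hcv hd he (a := a * t / (a * t + b * s)) (b := b * s / (a * t + b * s))
    (by positivity) (by positivity) (by field_simp) using 1
  have h1 : x = (a * t / (a * t + b * s) + b * s / (a * t + b * s)) • x := by
    rw [← add_div, div_self hst.ne', one_smul]
  nth_rewrite 1 [h1]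
  simp only [smul_add, add_smul, smul_smul]
  have h2 : s * t / (a * t + b * s) * a = a * t / (a * t + b * s) * s := by ring
  have h3 : s * t / (a * t + b * s) * b = b * s / (a * t + b * s) * t := by ring
  rw [h2, h3]
  abel

theorem zero_mem_tangentCone {C : Set F} {x : F} (hx : x ∈ C) : (0 : F) ∈ tangentCone C x :=
  subset_closure ⟨1, one_pos, by simpa using hx⟩

theorem inner_le_zero_of_mem_tangentCone {C : Set F} {x v d : F} (hv : v ∈ normalCone C x)
    (hd : d ∈ tangentCone C x) : inner ℝ v d ≤ 0 := by
  have hcl : IsClosed {d : F | inner ℝ v d ≤ 0} := isClosed_le (by fun_prop) continuous_const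
  refine (closure_minimal ?_ hcl) hd
  rintro e ⟨t, ht, he⟩
  have := hv _ he
  rw [add_sub_cancel_left, real_inner_smul_right] at this
  exact nonpos_of_mul_nonpos_right this ht

/-- The projected gradient is at most as long as the distance of the negative gradient from any
normal vector. -/
theorem norm_projGrad_le [CompleteSpace F] {C : Set F} (hcv : Convex ℝ C) {x v : F} (hx : x ∈ C)
    (hv : v ∈ normalCone C x) (L : F → ℝ) : ‖projGrad C L x‖ ≤ ‖-gradient L x - v‖ := by
  have h0 : proj (tangentCone C x) v = 0 :=
    proj_eq_of_inner_le isClosed_closure (convex_tangentCone hcv x) (zero_mem_tangentCone hx)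
      fun w hw => by simpa using inner_le_zero_of_mem_tangentCone hv hw
  have := norm_proj_sub_proj_le ⟨0, zero_mem_tangentCone hx⟩ isClosed_closure
    (convex_tangentCone hcv x) (-gradient L x) v
  rwa [h0, sub_zero] at this

end Tangent

/-! ### Relative interior of a cone -/

section RelativeInterior

variable {F : Type*} [NormedAddCommGroup F] [InnerProductSpace ℝ F]

/-- `N` contains all sufficiently short translates of `v` by differences of its own elements.
For a convex cone, whose differences fill its linear span, this says that `v` is in the relative
interior. -/
def InRelInterior (N : Set F) (v : F) : Prop :=
  ∃ ε > 0, ∀ a ∈ N, ∀ b ∈ N, ‖a - b‖ < ε → v + (a - b) ∈ N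

theorem inRelInterior_of_mem_intrinsicInterior {N : Set F} {v : F}
    (h : v ∈ intrinsicInterior ℝ N) : InRelInterior N v := by
  obtain ⟨p, hp, rfl⟩ := mem_intrinsicInterior.1 h
  obtain ⟨ε, hε, hb⟩ := Metric.isOpen_iff.1 isOpen_interior p hp
  refine ⟨ε, hε, fun a ha b hb' hab => ?_⟩
  have hmem : (p : F) + (a - b) ∈ affineSpan ℝ N := by
    have := AffineSubspace.vadd_mem_of_mem_direction
      (AffineSubspace.vsub_mem_direction (subset_affineSpan ℝ N ha) (subset_affineSpan ℝ N hb'))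
      p.2
    simpa [add_comm] using this
  have h2 : (⟨_, hmem⟩ : affineSpan ℝ N) ∈ Metric.ball p ε := by
    rw [Metric.mem_ball, Subtype.dist_eq, dist_eq_norm]
    simpa using hab
  exact interior_subset (s := ((↑) : affineSpan ℝ N → F) ⁻¹' N) (hb h2)

theorem InRelInterior.mem_normalCone {C : Set F} {x v : F}
    (h : InRelInterior (normalCone C x) v) : v ∈ normalCone C x := by
  obtain ⟨ε, hε, h⟩ := h
  simpa using h 0 (zero_mem_normalCone C x) 0 (zero_mem_normalCone C x) (by simpa using hε)

/-- From a relative interior point of a cone one can move a little against any element. -/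
theorem InRelInterior.exists_sub_smul_mem {C : Set F} {x v u : F}
    (h : InRelInterior (normalCone C x) v) (hu : u ∈ normalCone C x) :
    ∃ t : ℝ, 0 < t ∧ v - t • u ∈ normalCone C x := by
  obtain ⟨ε, hε, h⟩ := h
  have hpos : 0 < ‖u‖ + 1 := by positivity
  refine ⟨ε / (‖u‖ + 1), by positivity, ?_⟩
  have := h 0 (zero_mem_normalCone C x) _
    (smul_mem_normalCone (t := ε / (‖u‖ + 1)) (by positivity) hu) ?_
  · simpa [sub_eq_add_neg] using this
  · rw [zero_sub, norm_neg, norm_smul, Real.norm_of_nonneg (by positivity), div_mul_eq_mul_div,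
      div_lt_iff₀ hpos]
    nlinarith [norm_nonneg u]

/-- Normal vectors close to a relative interior point `v` dominate `v / 2`. -/
theorem InRelInterior.exists_two_smul_sub_mem {C : Set F} {x v : F}
    (h : InRelInterior (normalCone C x) v) :
    ∃ ε > 0, ∀ u ∈ normalCone C x, ‖u - v‖ < ε → (2 : ℝ) • u - v ∈ normalCone C x := by
  have hv := h.mem_normalCone
  obtain ⟨ε, hε, h⟩ := h
  refine ⟨ε / 2, by positivity, fun u hu huv => ?_⟩
  have := h _ (smul_mem_normalCone zero_le_two hu) _ (smul_mem_normalCone zero_le_two hv) ?_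
  · convert this using 1
    simp only [two_smul]
    abel
  · rw [← smul_sub, norm_smul, Real.norm_of_nonneg zero_le_two]
    linarith

end RelativeInterior

/-! ### Polyhedra and their active sets -/

namespace Constraints

variable {K : ℕ} {n : Fin K → ℕ} (P : Constraints n)

theorem isClosed_blockSet (k : Fin K) : IsClosed (P.blockSet k) := by
  have : P.blockSet k = ⋂ i, {u | inner ℝ (P.ω k i) u ≤ P.h k i} := by
    ext u; simp [blockSet]
  rw [this]
  exact isClosed_iInter fun i => isClosed_le (by fun_prop) continuous_const

theorem convex_blockSet (k : Fin K) : Convex ℝ (P.blockSet k) := by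
  intro u hu v hv a b ha hb hab i
  rw [inner_add_right, real_inner_smul_right, real_inner_smul_right]
  calc a * inner ℝ (P.ω k i) u + b * inner ℝ (P.ω k i) v
      ≤ a * P.h k i + b * P.h k i := by gcongr; exacts [hu i, hv i]
    _ = P.h k i := by rw [← add_mul, hab, one_mul]

theorem isClosed_feasible : IsClosed P.feasible := by
  have : P.feasible = ⋂ k, (fun x : Space n => x k) ⁻¹' P.blockSet k := by
    ext u; simp [feasible]
  rw [this]
  exact isClosed_iInter fun k => (P.isClosed_blockSet k).preimage (by fun_prop)

theorem convex_feasible : Convex ℝ P.feasible := fun _ hu _ hv _ _ ha hb hab k =>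
  P.convex_blockSet k (hu k) (hv k) ha hb hab

variable {P} {k : Fin K}

theorem ω_mem_normalCone {x : Block (n k)} {i : Fin (P.m k)} (hi : i ∈ P.blockActive k x) :
    P.ω k i ∈ normalCone (P.blockSet k) x := fun y hy => by
  have h1 := hy i
  have h2 : inner ℝ (P.ω k i) x = P.h k i := hi
  rw [inner_sub_right]
  linarith

/-- Constraints inactive at a point are inactive nearby. -/
theorem eventually_blockActive_subset {x : Block (n k)} (hx : x ∈ P.blockSet k) :
    ∀ᶠ u in 𝓝 x, P.blockActive k u ⊆ P.blockActive k x := by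
  have h : ∀ i, ∀ᶠ u in 𝓝 x, i ∈ P.blockActive k u → i ∈ P.blockActive k x := by
    intro i
    by_cases hi : i ∈ P.blockActive k x
    · exact Eventually.of_forall fun _ _ => hi
    · have hlt : inner ℝ (P.ω k i) x < P.h k i := lt_of_le_of_ne (hx i) hi
      have : ContinuousAt (fun u => inner ℝ (P.ω k i) u) x := by fun_prop
      filter_upwards [this.eventually_lt_const hlt] with u hu hu'
      exact absurd hu' hu.ne
  filter_upwards [eventually_all.2 h] with u hu i using hu i

/-- The normal cone of a polyhedron depends monotonically on the active set. -/
theorem normalCone_subset_of_blockActive_subset {z z' : Block (n k)} (hz : z ∈ P.blockSet k)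
    (h : P.blockActive k z ⊆ P.blockActive k z') :
    normalCone (P.blockSet k) z ⊆ normalCone (P.blockSet k) z' := by
  intro v hv y hy
  have hev : ∀ i, ∀ᶠ t : ℝ in 𝓝[>] 0, inner ℝ (P.ω k i) (z + t • (y - z')) ≤ P.h k i := by
    intro i
    by_cases hi : i ∈ P.blockActive k z
    · filter_upwards [self_mem_nhdsWithin] with t ht
      have h1 : inner ℝ (P.ω k i) z = P.h k i := hi
      have h2 := ω_mem_normalCone (h hi) y hy
      rw [inner_add_right, real_inner_smul_right, h1]
      have := mul_nonpos_of_nonneg_of_nonpos (le_of_lt ht) h2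
      linarith
    · have hlt : inner ℝ (P.ω k i) z < P.h k i := lt_of_le_of_ne (hz i) hi
      have : ContinuousAt (fun t : ℝ => inner ℝ (P.ω k i) (z + t • (y - z'))) 0 := by fun_prop
      have := this.eventually_lt_const (u := P.h k i) (by simpa using hlt)
      filter_upwards [nhdsWithin_le_nhds this] with t ht using ht.le
  obtain ⟨t, ht, ht0⟩ := ((eventually_all.2 hev).and self_mem_nhdsWithin).exists
  have := hv _ ht
  rw [add_sub_cancel_left, real_inner_smul_right] at this
  exact nonpos_of_mul_nonpos_right this ht0

/-- A polyhedron has finitely many normal cones, all closed: if the normal cone at some feasible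
point comes close enough to `v`, then it contains `v`. -/
theorem eventually_mem_normalCone (v : Block (n k)) :
    ∀ᶠ u in 𝓝 v, ∀ z ∈ P.blockSet k, u ∈ normalCone (P.blockSet k) z →
      v ∈ normalCone (P.blockSet k) z := by
  have h : ∀ I : Set (Fin (P.m k)), ∀ᶠ u in 𝓝 v, ∀ z ∈ P.blockSet k, P.blockActive k z = I →
      u ∈ normalCone (P.blockSet k) z → v ∈ normalCone (P.blockSet k) z := by
    intro I
    by_cases hI : ∃ z₀ ∈ P.blockSet k, P.blockActive k z₀ = I ∧
        v ∉ normalCone (P.blockSet k) z₀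
    · obtain ⟨z₀, hz₀, rfl, hv⟩ := hI
      filter_upwards [(isClosed_normalCone _ z₀).isOpen_compl.mem_nhds hv] with u hu z hz hzI huz
      exact absurd (normalCone_subset_of_blockActive_subset hz hzI.subset huz) hu
    · push Not at hI
      exact Eventually.of_forall fun u z hz hzI _ => hI z hz hzI
  filter_upwards [eventually_all.2 h] with u hu z hz using hu _ z hz rfl

/-- A vector in the relative interior of the normal cone at `x` is normal only at points where
all constraints active at `x` are active. -/
theorem blockActive_subset_of_mem_normalCone {x z v : Block (n k)}
    (hv : InRelInterior (normalCone (P.blockSet k) x) v) (hx : x ∈ P.blockSet k)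
    (hz : z ∈ P.blockSet k) (hvz : v ∈ normalCone (P.blockSet k) z) :
    P.blockActive k x ⊆ P.blockActive k z := by
  intro i hi
  obtain ⟨t, ht, hmem⟩ := hv.exists_sub_smul_mem (ω_mem_normalCone hi)
  have h1 := hmem z hz
  have h2 := hvz x hx
  have h3 : inner ℝ (P.ω k i) x = P.h k i := hi
  rw [inner_sub_left, real_inner_smul_left] at h1
  rw [← neg_sub, inner_neg_right] at h2
  have h4 : 0 ≤ inner ℝ (P.ω k i) (z - x) := by
    by_contra! hneg
    have := mul_neg_of_pos_of_neg ht hneg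
    linarith
  rw [inner_sub_right, h3] at h4
  exact le_antisymm (hz i) (by linarith)

/-- Identification by normal vectors: a normal vector close to a relative interior point of the
normal cone at `x` can only be attached to points where all constraints active at `x` are
active. -/
theorem exists_blockActive_subset {x v : Block (n k)}
    (hv : InRelInterior (normalCone (P.blockSet k) x) v) (hx : x ∈ P.blockSet k) :
    ∃ ε > 0, ∀ z ∈ P.blockSet k, ∀ u ∈ normalCone (P.blockSet k) z, ‖u - v‖ < ε →
      P.blockActive k x ⊆ P.blockActive k z := by
  obtain ⟨ε, hε, h⟩ := Metric.eventually_nhds_iff.1 (eventually_mem_normalCone (P := P) v)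
  exact ⟨ε, hε, fun z hz u hu huv => blockActive_subset_of_mem_normalCone hv hx hz
    (h (by rwa [dist_eq_norm]) z hz hu)⟩

/-- The normal cone of the product is the product of the normal cones. -/
theorem mem_normalCone_feasible_iff {x v : Space n} (hx : x ∈ P.feasible) :
    v ∈ normalCone P.feasible x ↔ ∀ k, v k ∈ normalCone (P.blockSet k) (x k) := by
  constructor
  · intro h k u hu
    let y : Space n := WithLp.toLp 2 (Function.update (WithLp.ofLp x) k u)
    have hy : y ∈ P.feasible := by
      intro j
      by_cases hj : j = k
      · subst hj; simpa [y] using hu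
      · simpa [y, hj] using hx j
    have := h y hy
    rw [PiLp.inner_apply, Finset.sum_eq_single k] at this
    · simpa [y] using this
    · intro j _ hj
      simp [y, hj]
    · simp
  · intro h y hy
    rw [PiLp.inner_apply]
    exact Finset.sum_nonpos fun k _ => h k _ (hy k)

theorem inRelInterior_block {x v : Space n} (hx : x ∈ P.feasible)
    (hv : InRelInterior (normalCone P.feasible x) v) (k : Fin K) :
    InRelInterior (normalCone (P.blockSet k) (x k)) (v k) := by
  obtain ⟨ε, hε, h⟩ := hv
  have hs : ∀ a ∈ normalCone (P.blockSet k) (x k),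
      (PiLp.single 2 k a : Space n) ∈ normalCone P.feasible x := by
    intro a ha
    rw [mem_normalCone_feasible_iff hx]
    intro j
    by_cases hj : j = k
    · subst hj; simpa using ha
    · simpa [hj] using zero_mem_normalCone _ _
  refine ⟨ε, hε, fun a ha b hb hab => ?_⟩
  have := (mem_normalCone_feasible_iff hx).1 (h _ (hs a ha) _ (hs b hb) ?_) k
  · simpa using this
  · have e : (PiLp.single 2 k a - PiLp.single 2 k b : Space n) = PiLp.single 2 k (a - b) :=
      (PiLp.single_sub 2 k).symm
    rw [e, PiLp.norm_single]
    exact hab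

end Constraints

/-! ### Taylor estimates and strict local minimality -/

section Growth

variable {F : Type*} [NormedAddCommGroup F] [InnerProductSpace ℝ F]

/-- First-order Taylor estimate on a convex set, uniform thanks to the uniform continuity of the
gradient. -/
theorem exists_abs_sub_sub_inner_gradient_le [CompleteSpace F] {C : Set F} (hcv : Convex ℝ C)
    {L : F → ℝ}
    (hdiff : ∀ x ∈ C, DifferentiableAt ℝ L x) (hgrad : UniformContinuousOn (gradient L) C)
    {ε : ℝ} (hε : 0 < ε) :
    ∃ r > 0, ∀ x ∈ C, ∀ y ∈ C, ‖y - x‖ < r →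
      |L y - L x - inner ℝ (gradient L x) (y - x)| ≤ ε * ‖y - x‖ := by
  obtain ⟨r, hr, h⟩ := Metric.uniformContinuousOn_iff.1 hgrad ε hε
  refine ⟨r, hr, fun x hx y hy hxy => ?_⟩
  have hsub : segment ℝ x y ⊆ C := hcv.segment_subset hx hy
  have := (convex_segment x y).norm_image_sub_le_of_norm_hasFDerivWithin_le'
    (f := L) (f' := fun ξ => InnerProductSpace.toDual ℝ F (gradient L ξ))
    (φ := InnerProductSpace.toDual ℝ F (gradient L x)) (C := ε)
    (fun ξ hξ => (hdiff ξ (hsub hξ)).hasGradientAt.hasFDerivAt.hasFDerivWithinAt)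
    (fun ξ hξ => ?_) (left_mem_segment ℝ x y) (right_mem_segment ℝ x y)
  · simpa using this
  · rw [← map_sub, LinearIsometryEquiv.norm_map, ← dist_eq_norm]
    refine (h ξ (hsub hξ) x hx ?_).le
    rw [dist_eq_norm, ← norm_sub_rev]
    obtain ⟨t, ht, rfl⟩ := (segment_eq_image' ℝ x y ▸ hξ :)
    rw [norm_sub_rev, add_sub_cancel_left, norm_smul, Real.norm_of_nonneg ht.1]
    nlinarith [ht.2, norm_nonneg (y - x)]

/-- Second-order Taylor expansion at a point where the gradient is differentiable. -/
theorem eventually_abs_sub_quadratic_le [CompleteSpace F] {C : Set F} (hcv : Convex ℝ C) {L : F → ℝ}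
    (hdiff : ∀ x ∈ C, DifferentiableAt ℝ L x) {xs : F} (hxs : xs ∈ C)
    (hH : DifferentiableAt ℝ (gradient L) xs) {ε : ℝ} (hε : 0 < ε) :
    ∀ᶠ x in 𝓝[C] xs, |L x - L xs - inner ℝ (gradient L xs) (x - xs)
      - 1 / 2 * inner ℝ (x - xs) (fderiv ℝ (gradient L) xs (x - xs))| ≤ ε * ‖x - xs‖ ^ 2 := by
  have h1 := (hH.hasFDerivAt.isLittleO.def hε)
  obtain ⟨r, hr, hball⟩ := Metric.eventually_nhds_iff.1 h1
  filter_upwards [self_mem_nhdsWithin,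
    nhdsWithin_le_nhds (Metric.ball_mem_nhds xs hr)] with x hx hxr
  set H := fderiv ℝ (gradient L) xs
  set s := x - xs with hs
  have hsr : ‖s‖ < r := by rwa [Metric.mem_ball, dist_eq_norm] at hxr
  have hmem : ∀ t ∈ Set.Icc (0 : ℝ) 1, xs + t • s ∈ C := fun t ht =>
    hcv.add_smul_sub_mem hxs hx ht
  have hd : ∀ t ∈ Set.Icc (0 : ℝ) 1, HasDerivWithinAt
      (fun t : ℝ => L (xs + t • s) - t * inner ℝ (gradient L xs) s - t ^ 2 / 2 * inner ℝ s (H s))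
      (inner ℝ (gradient L (xs + t • s)) s - 1 * inner ℝ (gradient L xs) s
        - t * inner ℝ s (H s)) (Set.Icc (0 : ℝ) 1) t := by
    intro t ht
    have e1 : HasDerivAt (fun t : ℝ => xs + t • s) s t := by
      simpa using ((hasDerivAt_id t).smul_const s).const_add xs
    have e2 := ((hdiff _ (hmem t ht)).hasGradientAt.hasFDerivAt.comp_hasDerivAt t e1)
    have e3 : HasDerivAt (fun t : ℝ => t ^ 2 / 2 * inner ℝ s (H s)) (t * inner ℝ s (H s)) t := by
      have := ((hasDerivAt_pow 2 t).div_const 2).mul_const (inner ℝ s (H s))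
      exact this.congr_deriv (by push_cast; ring)
    have e4 := (hasDerivAt_id t).mul_const (inner ℝ (gradient L xs) s)
    exact ((e2.sub e4).sub e3).hasDerivWithinAt
  have := norm_image_sub_le_of_norm_deriv_le_segment_01' (C := ε * ‖s‖ ^ 2) hd ?_
  · have e : xs + s = x := by rw [hs]; abel
    simp only [one_smul, zero_smul, add_zero, e, Real.norm_eq_abs] at this
    convert this using 2
    ring
  · intro t ht
    have hts : ‖t • s‖ ≤ ‖s‖ := by
      rw [norm_smul, Real.norm_of_nonneg ht.1]
      nlinarith [ht.2, norm_nonneg s]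
    have h2 := hball (y := xs + t • s) (by
      rw [dist_eq_norm, add_sub_cancel_left]
      exact hts.trans_lt hsr)
    rw [add_sub_cancel_left] at h2
    have e : inner ℝ (gradient L (xs + t • s)) s - 1 * inner ℝ (gradient L xs) s
        - t * inner ℝ s (H s) = inner ℝ (gradient L (xs + t • s) - gradient L xs - H (t • s)) s := by
      rw [inner_sub_left (_ - _), inner_sub_left (gradient L _), map_smul, real_inner_smul_left, real_inner_comm s (H s)]
      ring
    rw [e]
    calc ‖inner ℝ (gradient L (xs + t • s) - gradient L xs - H (t • s)) s‖
        ≤ ‖gradient L (xs + t • s) - gradient L xs - H (t • s)‖ * ‖s‖ := norm_inner_le_norm _ _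
      _ ≤ ε * ‖s‖ * ‖s‖ := by
        gcongr
        exact h2.trans (by gcongr)
      _ = ε * ‖s‖ ^ 2 := by ring

/-- A non-degenerate critical point satisfying the strong second-order condition is a strict local
minimiser: along feasible directions `d` that are not orthogonal to the normal cone the
objective grows to first order, along the others to second order. -/
theorem eventually_lt_of_strongSecondOrder [CompleteSpace F] [FiniteDimensional ℝ F] {C : Set F}
    (hcv : Convex ℝ C) {L : F → ℝ} (hdiff : ∀ x ∈ C, DifferentiableAt ℝ L x) {xs : F}
    (hxs : xs ∈ C) (hnd : InRelInterior (normalCone C xs) (-gradient L xs)) {κ : ℝ} (hκ : 0 < κ)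
    (hssoc : StrongSecondOrder C L xs κ) :
    ∀ᶠ x in 𝓝[C \ {xs}] xs, L xs < L x := by
  by_contra hcon
  obtain ⟨x, hx, hLx⟩ := exists_seq_forall_of_frequently (not_eventually.1 hcon)
  have hxmem : ∀ᶠ j in atTop, x j ∈ C \ {xs} := hx.eventually self_mem_nhdsWithin
  have hxC : Tendsto x atTop (𝓝[C] xs) := hx.mono_right (nhdsWithin_mono _ Set.sdiff_subset)
  have hx0 : Tendsto x atTop (𝓝 xs) := hx.mono_right nhdsWithin_le_nhds
  have hquad := hxC.eventually
    (eventually_abs_sub_quadratic_le hcv hdiff hxs hssoc.1 (ε := κ / 8) (by positivity))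
  have hr0 : Tendsto (fun j => ‖x j - xs‖) atTop (𝓝 0) := by
    simpa using (tendsto_sub_nhds_zero_iff.2 hx0).norm
  set H := fderiv ℝ (gradient L) xs
  obtain ⟨d, hd⟩ : ∃ d : ℕ → F, d = fun j => ‖x j - xs‖⁻¹ • (x j - xs) := ⟨_, rfl⟩
  obtain ⟨d₀, -, φ, hφ, hdlim⟩ := (isCompact_closedBall (0 : F) 1).tendsto_subseq (x := d)
    fun j => by
      rw [mem_closedBall_zero_iff, hd, norm_smul, norm_inv, norm_norm]
      exact inv_mul_le_one
  have hφ' := hφ.tendsto_atTop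
  have hpos : ∀ᶠ j in atTop, 0 < ‖x j - xs‖ ∧ x j ∈ C ∧ x j - xs = ‖x j - xs‖ • d j := by
    filter_upwards [hxmem] with j hj
    have : 0 < ‖x j - xs‖ := norm_pos_iff.2 (sub_ne_zero.2 hj.2)
    refine ⟨this, hj.1, ?_⟩
    rw [hd, smul_smul, mul_inv_cancel₀ this.ne', one_smul]
  have hnorm : ‖d₀‖ = 1 := by
    refine tendsto_nhds_unique hdlim.norm (tendsto_const_nhds.congr' ?_)
    filter_upwards [hφ'.eventually hpos] with j hj
    simp only [Function.comp, hd, norm_smul, norm_inv, norm_norm]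
    rw [inv_mul_cancel₀ hj.1.ne']
  -- the limit direction makes an obtuse angle with every normal vector
  have hN : ∀ w ∈ normalCone C xs, ∀ᶠ j in atTop, inner ℝ w (d j) ≤ 0 := by
    intro w hw
    filter_upwards [hpos] with j ⟨hj0, hjC, hj⟩
    have := hw _ hjC
    rw [hj, real_inner_smul_right] at this
    exact nonpos_of_mul_nonpos_right this hj0
  have hN' : ∀ w ∈ normalCone C xs, inner ℝ w d₀ ≤ 0 := fun w hw =>
    le_of_tendsto (tendsto_const_nhds.inner hdlim) (hφ'.eventually (hN w hw))
  have hmain : ∀ᶠ j in atTop, inner ℝ (gradient L xs) (d j) +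
      ‖x j - xs‖ * (1 / 2 * inner ℝ (d j) (H (d j))) ≤ ‖x j - xs‖ * (κ / 8) := by
    filter_upwards [hpos, hquad] with j ⟨hj0, hjC, hj⟩ hq
    have h1 := (abs_le.1 hq).1
    have h2 := not_lt.1 (hLx j)
    set r := ‖x j - xs‖
    rw [hj, map_smul, real_inner_smul_right, real_inner_smul_left, real_inner_smul_right] at h1
    have h3 : r * (inner ℝ (gradient L xs) (d j) + r * (1 / 2 * inner ℝ (d j) (H (d j))))
        ≤ r * (r * (κ / 8)) := by nlinarith
    exact le_of_mul_le_mul_left h3 hj0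
  have hHlim : Tendsto (fun j => (inner ℝ (d (φ j)) (H (d (φ j))) : ℝ)) atTop
      (𝓝 (inner ℝ d₀ (H d₀))) := hdlim.inner ((H.continuous.tendsto _).comp hdlim)
  have hrφ : Tendsto (fun j => ‖x (φ j) - xs‖) atTop (𝓝 0) := hr0.comp hφ'
  have hg0 : inner ℝ (gradient L xs) d₀ ≤ 0 := by
    have h1 : Tendsto (fun j => (inner ℝ (gradient L xs) (d (φ j)) : ℝ) +
        ‖x (φ j) - xs‖ * (1 / 2 * inner ℝ (d (φ j)) (H (d (φ j))))) atTop
        (𝓝 (inner ℝ (gradient L xs) d₀ + 0 * (1 / 2 * inner ℝ d₀ (H d₀)))) :=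
      (tendsto_const_nhds.inner hdlim).add (hrφ.mul (hHlim.const_mul _))
    have h2 := le_of_tendsto_of_tendsto h1 (hrφ.mul_const (κ / 8)) (hφ'.eventually hmain)
    simpa using h2
  have horth : ∀ w ∈ normalCone C xs, inner ℝ w d₀ = 0 := by
    intro w hw
    obtain ⟨t, ht, hmem⟩ := hnd.exists_sub_smul_mem hw
    have h1 := hN' _ hmem
    rw [inner_sub_left, inner_neg_left, real_inner_smul_left] at h1
    have h2 : 0 ≤ inner ℝ w d₀ := by
      by_contra! hneg
      have := mul_neg_of_pos_of_neg ht hneg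
      linarith
    exact le_antisymm (hN' w hw) h2
  have hcurv := hssoc.2 d₀ horth
  have hle : inner ℝ d₀ (H d₀) ≤ κ / 4 := by
    refine le_of_tendsto hHlim (hφ'.eventually (p := fun j => inner ℝ (d j) (H (d j)) ≤ κ / 4) ?_)
    filter_upwards [hpos, hmain, hN _ hnd.mem_normalCone] with j hj hm hn
    rw [inner_neg_left] at hn
    have : ‖x j - xs‖ * (1 / 2 * inner ℝ (d j) (H (d j))) ≤ ‖x j - xs‖ * (κ / 8) := by linarith
    have := le_of_mul_le_mul_left this hj.1
    linarith
  rw [hnorm] at hcurv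
  linarith

/-- A sequence in a closed set along which the objective decreases and whose steps tend to zero
converges to each of its cluster points that is a strict local minimiser. -/
theorem tendsto_of_mapClusterPt_strict_min [FiniteDimensional ℝ F] {C : Set F}
    (hcl : IsClosed C) {L : F → ℝ} (hcont : ContinuousOn L C) {xs : F}
    (hmin : ∀ᶠ x in 𝓝[C \ {xs}] xs, L xs < L x) {x : ℕ → F} (hxC : ∀ l, x l ∈ C)
    (hlim : MapClusterPt xs atTop x) (hL : Tendsto (fun l => L (x l)) atTop (𝓝 (L xs)))
    (hstep : Tendsto (fun l => ‖x (l + 1) - x l‖) atTop (𝓝 0)) : Tendsto x atTop (𝓝 xs) := by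
  obtain ⟨r₀, hr₀, hball⟩ := Metric.mem_nhdsWithin_iff.1 hmin
  rw [Metric.tendsto_atTop]
  intro r' hr'
  set r := min r' r₀ with hrdef
  have hr : 0 < r := lt_min hr' hr₀
  -- on the annulus `A` the objective exceeds its limit by a fixed amount, so that late iterates
  -- can neither lie in it nor step across it
  set A : Set F := C ∩ {w | r / 2 ≤ dist w xs} ∩ Metric.closedBall xs (3 * r / 4) with hA
  have hAc : IsCompact A := (isCompact_closedBall xs (3 * r / 4)).inter_left
    (hcl.inter (isClosed_le continuous_const (by fun_prop)))
  have hAC : A ⊆ C := fun w hw => hw.1.1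
  have hgt : ∀ w ∈ A, L xs < L w := fun w hw => by
    refine hball ⟨?_, hw.1.1, ?_⟩
    · have h1 : dist w xs ≤ 3 * r / 4 := hw.2
      have h2 : r ≤ r₀ := min_le_right _ _
      rw [Metric.mem_ball]; linarith
    · rintro rfl
      have h1 : r / 2 ≤ dist w w := hw.1.2
      rw [dist_self] at h1; linarith
  have hout : ∀ᶠ l in atTop, x l ∉ A := by
    rcases A.eq_empty_or_nonempty with hAe | hAne
    · simp [hAe]
    · obtain ⟨w, hw, hwmin⟩ := hAc.exists_isMinOn hAne (hcont.mono hAC)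
      filter_upwards [hL.eventually_lt_const (hgt w hw)] with l hl hlA
      exact absurd (hwmin hlA) (not_le.2 hl)
  have hs : ∀ᶠ l in atTop, ‖x (l + 1) - x l‖ < r / 4 :=
    hstep.eventually_lt_const (by positivity)
  obtain ⟨l₁, hl₁⟩ := eventually_atTop.1 (hout.and hs)
  obtain ⟨l₂, hl₂, hnear⟩ := frequently_atTop.1
    (hlim.frequently (Metric.ball_mem_nhds xs (half_pos hr))) l₁
  have hstay : ∀ l ≥ l₂, dist (x l) xs < r / 2 := by
    intro l hl
    induction l, hl using Nat.le_induction with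
    | base => exact hnear
    | succ l hl ih =>
      by_contra! hfar
      refine (hl₁ (l + 1) (by omega)).1 ⟨⟨hxC _, hfar⟩, ?_⟩
      have h1 := dist_triangle (x (l + 1)) (x l) xs
      have h2 := (hl₁ l (by omega)).2
      rw [← dist_eq_norm] at h2
      rw [Metric.mem_closedBall]
      linarith
  refine ⟨l₂, fun l hl => (hstay l hl).trans_le ?_⟩
  have : r ≤ r' := min_le_left _ _
  linarith

end Growth

/-! ### Comparison of the norms -/

section Norms

theorem blockSupNorm_le_norm {d : ℕ} (v : Block d) : blockSupNorm v ≤ ‖v‖ :=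
  (pi_norm_le_iff_of_nonneg (norm_nonneg v)).2 fun i => PiLp.norm_apply_le v i

theorem norm_le_sum_norm_apply {ι : Type*} [Fintype ι] {β : ι → Type*}
    [∀ i, SeminormedAddCommGroup (β i)] (v : PiLp 2 β) : ‖v‖ ≤ ∑ i, ‖v i‖ := by
  rw [PiLp.norm_eq_of_L2]
  exact Real.sqrt_le_iff.2 ⟨Finset.sum_nonneg fun i _ => norm_nonneg _,
    Finset.sum_sq_le_sq_sum_of_nonneg fun i _ => norm_nonneg _⟩

theorem norm_le_mul_supNorm {K : ℕ} {n : Fin K → ℕ} (v : Space n) :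
    ‖v‖ ≤ (∑ k, (n k : ℝ)) * supNorm v := by
  refine (norm_le_sum_norm_apply v).trans ?_
  rw [Finset.sum_mul]
  refine Finset.sum_le_sum fun k _ => (norm_le_sum_norm_apply (v k)).trans ?_
  have h1 : ∀ i, ‖v k i‖ ≤ supNorm v := fun i =>
    (norm_le_pi_norm (WithLp.ofLp (v k)) i).trans
      (norm_le_pi_norm (fun k => WithLp.ofLp (v k) : ∀ k, Fin (n k) → ℝ) k)
  calc ∑ i, ‖v k i‖ ≤ ∑ _i : Fin (n k), supNorm v := Finset.sum_le_sum fun i _ => h1 i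
    _ = n k * supNorm v := by simp

end Norms

/-! ### The quadratic model along a sweep -/

section Model

variable {F : Type*} [NormedAddCommGroup F] [InnerProductSpace ℝ F] [CompleteSpace F]

theorem gradient_model {L : F → ℝ} {B : F → F →L[ℝ] F} {x : F}
    (hB : (B x).toLinearMap.IsSymmetric) (w : F) :
    gradient (model L B x) w = gradient L x + B x (w - x) := by
  refine HasGradientAt.gradient ?_
  rw [hasGradientAt_iff_hasFDerivAt]
  have h1 : HasFDerivAt (fun w : F => w - x) (ContinuousLinearMap.id ℝ F) w :=
    (hasFDerivAt_id w).sub_const x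
  have h2 : HasFDerivAt (fun w : F => B x (w - x)) (B x) w :=
    (B x).hasFDerivAt.comp w h1
  have h3 := (h1.inner ℝ h2).const_mul (1 / 2)
  have h4 := ((innerSL ℝ (gradient L x)).hasFDerivAt.comp w h1).const_add (L x)
  refine (h4.add h3).congr_fderiv ?_
  ext v
  have h5 : inner ℝ (w - x) (B x v) = inner ℝ v (B x (w - x)) := by
    rw [real_inner_comm]
    exact hB v (w - x)
  simp only [_root_.add_apply, _root_.smul_apply,
    ContinuousLinearMap.comp_apply, ContinuousLinearMap.prod_apply, ContinuousLinearMap.id_apply,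
    fderivInnerCLM_apply, innerSL_apply_apply, InnerProductSpace.toDual_apply_apply, h5, smul_eq_mul,
    inner_add_left, real_inner_comm v (B x (w - x))]
  ring

theorem model_eq_add {L : F → ℝ} {B : F → F →L[ℝ] F} {x : F}
    (hB : (B x).toLinearMap.IsSymmetric) (w u : F) :
    model L B x u = model L B x w + inner ℝ (gradient (model L B x) w) (u - w)
      + 1 / 2 * inner ℝ (u - w) (B x (u - w)) := by
  rw [gradient_model hB]
  have h1 : inner ℝ (B x (u - w)) (w - x) = inner ℝ (u - w) (B x (w - x)) := hB (u - w) (w - x)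
  have e : u - x = (u - w) + (w - x) := by abel
  simp only [model]
  rw [e, map_add]
  simp only [inner_add_left, inner_add_right]
  rw [real_inner_comm (B x (u - w)) (w - x), real_inner_comm (u - w) (B x (w - x)), h1]
  ring

theorem model_self (L : F → ℝ) (B : F → F →L[ℝ] F) (x : F) : model L B x x = L x := by
  simp [model]

end Model

section Sweep

variable {K : ℕ} {n : Fin K → ℕ}

/-- The point reached by a sweep from `x` towards `z` after its first `j` blocks. -/
noncomputable def partialSweep (z x : Space n) (j : ℕ) : Space n :=
  WithLp.toLp 2 fun i => if (i : ℕ) < j then z i else x i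

theorem sweep_self_left (z x : Space n) (k : Fin K) :
    sweep z x k (x k) = partialSweep z x k := by
  ext i : 1
  by_cases h : i = k
  · subst h; simp [sweep, partialSweep]
  · simp [sweep, partialSweep, h]

theorem sweep_self_right (z x : Space n) (k : Fin K) :
    sweep z x k (z k) = partialSweep z x (k + 1) := by
  ext i : 1
  by_cases h : i = k
  · subst h; simp [sweep, partialSweep]
  · have h2 : i < k ↔ i ≤ k := (Ne.le_iff_lt h).symm
    simp [sweep, partialSweep, h, h2]

theorem partialSweep_zero (z x : Space n) : partialSweep z x 0 = x := by
  ext i : 1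
  simp [partialSweep]

theorem partialSweep_last (z x : Space n) : partialSweep z x K = z := by
  ext i : 1
  simp [partialSweep]

theorem sweep_sub_sweep (z x : Space n) (k : Fin K) (u v : Block (n k)) :
    sweep z x k u - sweep z x k v = PiLp.single 2 k (u - v) := by
  ext i : 1
  by_cases h : i = k
  · subst h; simp [sweep]
  · simp [sweep, h]

theorem inner_single_right (g : Space n) (k : Fin K) (u : Block (n k)) :
    inner ℝ g (PiLp.single 2 k u : Space n) = inner ℝ (g k) u := by
  rw [PiLp.inner_apply, Finset.sum_eq_single k]
  · simp
  · intro j _ hj; simp [hj]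
  · simp

variable {P : Constraints n} {L : Space n → ℝ} {B : Space n → Space n →L[ℝ] Space n} {q : Params}
  {x z : Space n} {k : Fin K}

theorem sweepGrad_eq (hB : (B x).toLinearMap.IsSymmetric) :
    sweepGrad L B x z k = gradient L x k + B x (partialSweep z x k - x) k := by
  rw [sweepGrad, gradient_model hB, sweep_self_left]
  rfl

theorem model_sweep_le (hB : (B x).toLinearMap.IsSymmetric) (v : Block (n k)) :
    model L B x (sweep z x k v) ≤ model L B x (sweep z x k (x k)) +
      inner ℝ (sweepGrad L B x z k) (v - x k) + 1 / 2 * (‖B x‖ * ‖v - x k‖ ^ 2) := by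
  rw [model_eq_add hB (sweep z x k (x k)), sweep_sub_sweep, inner_single_right]
  have h : (inner ℝ (PiLp.single 2 k (v - x k) : Space n)
      (B x (PiLp.single 2 k (v - x k))) : ℝ) ≤ ‖B x‖ * ‖v - x k‖ ^ 2 := by
    refine (real_inner_le_norm _ _).trans ?_
    have := (B x).le_opNorm (PiLp.single 2 k (v - x k))
    rw [PiLp.norm_single] at this ⊢
    nlinarith [norm_nonneg (v - x k)]
  rw [sweepGrad]
  linarith

theorem trialBlock_eq (a : ℝ) : trialBlock P L B x z k a =
    proj (P.blockSet k) (x k + a • (-sweepGrad L B x z k)) := by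
  rw [trialBlock, smul_neg, sub_eq_add_neg]

/-- All sufficiently small step-sizes satisfy the sufficient decrease condition. -/
theorem sufficientDecrease_trialBlock (hB : (B x).toLinearMap.IsSymmetric) (hx : x ∈ P.feasible)
    {a : ℝ} (ha : 0 < a) (haB : a * ‖B x‖ ≤ 2 * (1 - q.ν₀)) :
    SufficientDecrease L B q x z k (trialBlock P L B x z k a) := by
  have h1 := model_sweep_le (L := L) (z := z) (k := k) hB (trialBlock P L B x z k a)
  have h2 := norm_sq_le_inner_proj (P.isClosed_blockSet k) (P.convex_blockSet k) (hx k)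
    (-sweepGrad L B x z k) a
  rw [← trialBlock_eq, inner_neg_left] at h2
  rw [SufficientDecrease]
  set s := trialBlock P L B x z k a - x k
  set g := sweepGrad L B x z k
  have h3 : a * (‖B x‖ * ‖s‖ ^ 2) ≤ a * (2 * (1 - q.ν₀) * -inner ℝ g s) := by
    have h4 := mul_le_mul_of_nonneg_right haB (sq_nonneg ‖s‖)
    have h5 := mul_le_mul_of_nonneg_left h2 (by linarith [q.hν₀.2] : 0 ≤ 2 * (1 - q.ν₀))
    nlinarith
  have h6 := le_of_mul_le_mul_left h3 ha
  linarith

end Sweep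

/-! ### Descent properties of a single iteration -/

namespace IsCauchyPoint

variable {K : ℕ} {n : Fin K → ℕ} {P : Constraints n} {L : Space n → ℝ}
  {B : Space n → Space n →L[ℝ] Space n} {q : Params} {x z : Space n} {Δ : ℝ} {α : Fin K → ℝ}
  (h : IsCauchyPoint P L B q x Δ α z)

include h

theorem stepSize_pos (k : Fin K) : 0 < α k := by
  rcases (h k).2.2.2 with ha | ⟨a, ha0, ha, -⟩
  · exact q.hν.2.1.trans_le ha.1
  · exact (mul_pos q.hν.1 ha0).trans_le ha.1

theorem stepSize_le (k : Fin K) : α k ≤ q.ν₅ := by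
  rcases (h k).2.2.2 with ha | ⟨a, ha0, ha, -⟩
  exacts [ha.2, ha.2]

theorem eq_proj (k : Fin K) :
    z k = proj (P.blockSet k) (x k + α k • (-sweepGrad L B x z k)) := by
  rw [← trialBlock_eq]; exact (h k).1

theorem mem_feasible (hx : x ∈ P.feasible) : z ∈ P.feasible := fun k => by
  rw [h.eq_proj k]
  exact proj_mem ⟨_, hx k⟩ (P.isClosed_blockSet k) (P.convex_blockSet k) _

theorem norm_sq_le (hx : x ∈ P.feasible) (k : Fin K) :
    ‖z k - x k‖ ^ 2 ≤ α k * inner ℝ (-sweepGrad L B x z k) (z k - x k) := by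
  have := norm_sq_le_inner_proj (P.isClosed_blockSet k) (P.convex_blockSet k) (hx k)
    (-sweepGrad L B x z k) (α k)
  rwa [← h.eq_proj k] at this

theorem inner_nonneg (hx : x ∈ P.feasible) (k : Fin K) :
    0 ≤ inner ℝ (-sweepGrad L B x z k) (z k - x k) :=
  nonneg_of_mul_nonneg_right ((sq_nonneg _).trans (h.norm_sq_le hx k)) (h.stepSize_pos k)

theorem sum_inner_le :
    q.ν₀ * ∑ k, inner ℝ (-sweepGrad L B x z k) (z k - x k) ≤
      model L B x x - model L B x z := by
  have h1 : ∀ k : Fin K, q.ν₀ * inner ℝ (-sweepGrad L B x z k) (z k - x k) ≤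
      model L B x (partialSweep z x k) - model L B x (partialSweep z x (k + 1)) := by
    intro k
    have := (h k).2.1
    rw [SufficientDecrease, sweep_self_left, sweep_self_right] at this
    rw [inner_neg_left]
    linarith
  rw [Finset.mul_sum]
  refine (Finset.sum_le_sum fun k _ => h1 k).trans_eq ?_
  rw [Fin.sum_univ_eq_sum_range
      (fun j => model L B x (partialSweep z x j) - model L B x (partialSweep z x (j + 1))) K,
    Finset.sum_range_sub', partialSweep_zero, partialSweep_last]

theorem inner_le (hx : x ∈ P.feasible) (k : Fin K) :
    q.ν₀ * inner ℝ (-sweepGrad L B x z k) (z k - x k) ≤ model L B x x - model L B x z := by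
  refine le_trans ?_ h.sum_inner_le
  have := q.hν₀.1
  gcongr
  exact Finset.single_le_sum (f := fun k => inner ℝ (-sweepGrad L B x z k) (z k - x k))
    (fun k _ => h.inner_nonneg hx k) (Finset.mem_univ k)

theorem norm_sq_le_model (hx : x ∈ P.feasible) :
    q.ν₀ / q.ν₅ * ‖z - x‖ ^ 2 ≤ model L B x x - model L B x z := by
  refine le_trans ?_ h.sum_inner_le
  rw [div_mul_eq_mul_div, mul_div_assoc]
  have := q.hν₀.1
  have h5 := q.hν.2.2
  gcongr
  rw [PiLp.norm_sq_eq_of_L2, Finset.sum_div]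
  refine Finset.sum_le_sum fun k _ => ?_
  rw [div_le_iff₀ h5]
  have h1 := h.norm_sq_le hx k
  have h2 := mul_le_mul_of_nonneg_right (h.stepSize_le k) (h.inner_nonneg hx k)
  rw [PiLp.sub_apply]
  linarith

end IsCauchyPoint

namespace IsRefinement

variable {K : ℕ} {n : Fin K → ℕ} {P : Constraints n} {L : Space n → ℝ}
  {B : Space n → Space n →L[ℝ] Space n} {q : Params} {x z y : Space n} {Δ σ : ℝ} {α : Fin K → ℝ}

/-- The constant of the quadratic lower bound on the predicted decrease. -/
noncomputable def decreaseConst (q : Params) : ℝ :=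
  min (q.ν₀ / q.ν₅) (q.regLo / 2) / 2

theorem decreaseConst_pos (q : Params) : 0 < decreaseConst q :=
  half_pos (lt_min (div_pos q.hν₀.1 q.hν.2.2) (half_pos q.hreg))

variable (h : IsRefinement P L B q x Δ σ z y) (hc : IsCauchyPoint P L B q x Δ α z)

include h hc

/-- The predicted decrease bounds the squared length of the step: the projected sweep bounds
`‖z - x‖` and the regularisation bounds `‖y - z‖`. -/
theorem norm_sq_le (hx : x ∈ P.feasible) (hσ : q.regLo ≤ σ) :
    decreaseConst q * ‖y - x‖ ^ 2 ≤ model L B x x - model L B x y := by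
  have h1 := hc.norm_sq_le_model hx
  have h2 := h.2.2.2.2
  set c := min (q.ν₀ / q.ν₅) (q.regLo / 2) with hcdef
  have hc0 : 0 < c := lt_min (div_pos q.hν₀.1 q.hν.2.2) (half_pos q.hreg)
  have h3 : c * ‖z - x‖ ^ 2 ≤ q.ν₀ / q.ν₅ * ‖z - x‖ ^ 2 := by
    gcongr; exact min_le_left _ _
  have h4 : c * ‖y - z‖ ^ 2 ≤ σ / 2 * ‖y - z‖ ^ 2 := by
    gcongr
    exact (min_le_right _ _).trans (by linarith)
  have h5 : ‖y - x‖ ^ 2 ≤ 2 * (‖z - x‖ ^ 2 + ‖y - z‖ ^ 2) := by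
    have h6 : ‖y - x‖ ≤ ‖y - z‖ + ‖z - x‖ := norm_sub_le_norm_sub_add_norm_sub y z x
    have h7 := pow_le_pow_left₀ (norm_nonneg _) h6 2
    nlinarith [sq_nonneg (‖y - z‖ - ‖z - x‖)]
  rw [decreaseConst, ← hcdef]
  nlinarith

theorem model_nonneg (hx : x ∈ P.feasible) (hσ : q.regLo ≤ σ) :
    0 ≤ model L B x x - model L B x y :=
  le_trans (by have := decreaseConst_pos q; positivity) (h.norm_sq_le hc hx hσ)

theorem inner_le (hx : x ∈ P.feasible) (k : Fin K) :
    q.γ₁ * q.ν₀ * inner ℝ (-sweepGrad L B x z k) (z k - x k) ≤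
      model L B x x - model L B x y := by
  refine le_trans ?_ h.2.1
  rw [mul_assoc]
  exact mul_le_mul_of_nonneg_left (hc.inner_le hx k) q.hγ.1.le

omit hc in
theorem norm_le_radius :
    ‖y - x‖ ≤ (∑ k, (n k : ℝ)) * q.γ₂ * Δ := by
  refine (norm_le_mul_supNorm _).trans ?_
  rw [mul_assoc]
  exact mul_le_mul_of_nonneg_left h.2.2.1 (by positivity)

end IsRefinement

section Update

variable {K : ℕ} {n : Fin K → ℕ} {L : Space n → ℝ}
  {B : Space n → Space n →L[ℝ] Space n} {q : Params} {x y x' : Space n} {Δ Δ' : ℝ}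

/-- An iteration either leaves the iterate and reduces the radius, or accepts the refined point
with a decrease of the objective proportional to the predicted one. -/
theorem IsUpdate.fail_or_accept (h : IsUpdate L B q x Δ y x' Δ') (hΔ : 0 < Δ)
    (hm : 0 ≤ model L B x x - model L B x y) :
    (ratio L B x y < q.η₁ ∧ x' = x ∧ q.σ₁ * Δ ≤ Δ' ∧ Δ' ≤ q.σ₂ * Δ) ∨
    (x' = y ∧ q.η₁ * (model L B x x - model L B x y) ≤ L x - L x' ∧
      q.σ₁ * Δ ≤ Δ' ∧ Δ' ≤ q.σ₃ * Δ) := by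
  have hdec : q.η₁ ≤ ratio L B x y →
      q.η₁ * (model L B x x - model L B x y) ≤ L x - L y := by
    intro hr
    rcases hm.eq_or_lt with h0 | hpos
    · rw [ratio, ← h0, div_zero] at hr
      exact absurd hr (not_le.2 q.hη.1)
    · exact (le_div_iff₀ hpos).1 hr
  rcases lt_or_ge (ratio L B x y) q.η₁ with hr | hr
  · obtain ⟨h1, h2, h3⟩ := h.1 hr
    exact Or.inl ⟨hr, h1, h2, h3⟩
  · right
    rcases le_or_gt (ratio L B x y) q.η₂ with hr2 | hr2
    · obtain ⟨rfl, h2, h3⟩ := h.2.1 ⟨hr, hr2⟩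
      exact ⟨rfl, hdec hr, h2, h3⟩
    · obtain ⟨rfl, h2, h3⟩ := h.2.2 hr2
      refine ⟨rfl, hdec hr, le_trans ?_ h2, h3⟩
      exact mul_le_of_le_one_left hΔ.le (q.hσ.2.1.trans q.hσ.2.2.1).le

/-- If the model error is small compared to the predicted decrease, the iteration is very
successful. -/
theorem lt_ratio_of_abs_sub_lt
    (h : |L y - model L B x y| < (1 - q.η₂) * (model L B x x - model L B x y)) :
    q.η₂ < ratio L B x y := by
  have h1 : 0 < model L B x x - model L B x y :=
    pos_of_mul_pos_right ((abs_nonneg _).trans_lt h) (by linarith [q.hη.2.2])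
  rw [ratio, lt_div_iff₀ h1]
  have h2 := (abs_lt.1 h).2
  rw [model_self] at h1 h2 ⊢
  linarith

end Update

/-! ### Convergence of the iterates and of the Cauchy points -/

namespace IsRun

variable {K : ℕ} {n : Fin K → ℕ} {P : Constraints n} {L : Space n → ℝ}
  {B : Space n → Space n →L[ℝ] Space n} {q : Params} {x z y : ℕ → Space n} {Δ σ : ℕ → ℝ}
  {α : ℕ → Fin K → ℝ} (h : IsRun P L B q x z y Δ σ α)

include h

theorem mem_and_radius_pos (l : ℕ) : x l ∈ P.feasible ∧ 0 < Δ l := by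
  induction l with
  | zero => exact ⟨h.init_mem, h.init_radius⟩
  | succ l ih =>
    have hm := (h.refine l).model_nonneg (h.cauchy l) ih.1 (h.reg l).1.le
    rcases (h.update l).fail_or_accept ih.2 hm with ⟨-, h1, h2, -⟩ | ⟨h1, -, h2, -⟩
    · exact ⟨h1 ▸ ih.1, (mul_pos q.hσ.1 ih.2).trans_le h2⟩
    · exact ⟨h1 ▸ (h.refine l).1, (mul_pos q.hσ.1 ih.2).trans_le h2⟩

theorem mem (l : ℕ) : x l ∈ P.feasible := (h.mem_and_radius_pos l).1

theorem radius_pos (l : ℕ) : 0 < Δ l := (h.mem_and_radius_pos l).2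

theorem cauchy_mem (l : ℕ) : z l ∈ P.feasible := (h.cauchy l).mem_feasible (h.mem l)

theorem model_nonneg (l : ℕ) : 0 ≤ model L B (x l) (x l) - model L B (x l) (y l) :=
  (h.refine l).model_nonneg (h.cauchy l) (h.mem l) (h.reg l).1.le

theorem fail_or_accept (l : ℕ) :
    (ratio L B (x l) (y l) < q.η₁ ∧ x (l + 1) = x l ∧
      q.σ₁ * Δ l ≤ Δ (l + 1) ∧ Δ (l + 1) ≤ q.σ₂ * Δ l) ∨
    (x (l + 1) = y l ∧
      q.η₁ * (model L B (x l) (x l) - model L B (x l) (y l)) ≤ L (x l) - L (x (l + 1)) ∧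
      q.σ₁ * Δ l ≤ Δ (l + 1) ∧ Δ (l + 1) ≤ q.σ₃ * Δ l) :=
  (h.update l).fail_or_accept (h.radius_pos l) (h.model_nonneg l)

theorem norm_sq_step_le (l : ℕ) :
    q.η₁ * IsRefinement.decreaseConst q * ‖x (l + 1) - x l‖ ^ 2 ≤ L (x l) - L (x (l + 1)) := by
  rcases h.fail_or_accept l with ⟨-, h1, -⟩ | ⟨h1, h2, -⟩
  · simp [h1]
  · refine le_trans ?_ h2
    rw [mul_assoc, h1]
    exact mul_le_mul_of_nonneg_left
      ((h.refine l).norm_sq_le (h.cauchy l) (h.mem l) (h.reg l).1.le) q.hη.1.le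

theorem antitone : Antitone fun l => L (x l) :=
  antitone_nat_of_succ_le fun l => by
    have h1 := h.norm_sq_step_le l
    have h2 : 0 ≤ q.η₁ * IsRefinement.decreaseConst q * ‖x (l + 1) - x l‖ ^ 2 :=
      mul_nonneg (mul_nonneg q.hη.1.le (IsRefinement.decreaseConst_pos q).le) (sq_nonneg _)
    linarith

variable {xs : Space n}

theorem limit_mem (hlim : MapClusterPt xs atTop x) : xs ∈ P.feasible := by
  have : ClusterPt xs (𝓟 P.feasible) :=
    hlim.clusterPt.mono (tendsto_principal.2 (Eventually.of_forall h.mem))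
  exact P.isClosed_feasible.closure_subset (mem_closure_iff_clusterPt.2 this)

theorem tendsto_objective (hbdd : BddBelow (L '' {w | w ∈ P.feasible ∧ L w ≤ L (x 0)}))
    (hcont : ContinuousAt L xs) (hlim : MapClusterPt xs atTop x) :
    Tendsto (fun l => L (x l)) atTop (𝓝 (L xs)) := by
  have hb : BddBelow (Set.range fun l => L (x l)) := hbdd.mono (by
    rintro _ ⟨l, rfl⟩
    exact ⟨x l, ⟨h.mem l, h.antitone (Nat.zero_le l)⟩, rfl⟩)
  have h1 := tendsto_atTop_ciInf h.antitone hb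
  have h2 : MapClusterPt (L xs) atTop fun l => L (x l) := hlim.continuousAt_comp hcont
  have h3 : L xs = ⨅ l, L (x l) := by
    have h4 : NeBot (𝓝 (L xs) ⊓ 𝓝 (⨅ l, L (x l))) :=
      h2.clusterPt.neBot.mono (inf_le_inf_left _ h1)
    exact eq_of_nhds_neBot h4
  rwa [h3]

theorem tendsto_norm_step {c : ℝ} (hL : Tendsto (fun l => L (x l)) atTop (𝓝 c)) :
    Tendsto (fun l => ‖x (l + 1) - x l‖) atTop (𝓝 0) := by
  have h1 : Tendsto (fun l => L (x l) - L (x (l + 1))) atTop (𝓝 0) := by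
    simpa using hL.sub (hL.comp (tendsto_add_atTop_nat 1))
  set C := q.η₁ * IsRefinement.decreaseConst q with hC
  have hC0 : 0 < C := mul_pos q.hη.1 (IsRefinement.decreaseConst_pos q)
  have h2 : Tendsto (fun l => ‖x (l + 1) - x l‖ ^ 2) atTop (𝓝 0) := by
    refine squeeze_zero (fun l => sq_nonneg _) (fun l => ?_) (by simpa using h1.div_const C)
    rw [le_div_iff₀ hC0, mul_comm]
    exact h.norm_sq_step_le l
  simpa using h2.sqrt

/-- The iterates converge: the limit point is a strict local minimiser, the objective values
decrease and the steps tend to zero. -/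
theorem tendsto_iterates (hbdd : BddBelow (L '' {w | w ∈ P.feasible ∧ L w ≤ L (x 0)}))
    (hdiff : ∀ w ∈ P.feasible, DifferentiableAt ℝ L w) (hlim : MapClusterPt xs atTop x)
    (hnd : InRelInterior (normalCone P.feasible xs) (-gradient L xs)) {κ : ℝ} (hκ : 0 < κ)
    (hssoc : StrongSecondOrder P.feasible L xs κ) : Tendsto x atTop (𝓝 xs) := by
  have hxs := h.limit_mem hlim
  have hL := h.tendsto_objective hbdd (hdiff xs hxs).continuousAt hlim
  exact tendsto_of_mapClusterPt_strict_min P.isClosed_feasible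
    (fun w hw => (hdiff w hw).continuousAt.continuousWithinAt)
    (eventually_lt_of_strongSecondOrder P.convex_feasible hdiff hxs hnd hκ hssoc) h.mem hlim hL
    (h.tendsto_norm_step hL)

variable {Bhat : ℝ} (hBsymm : ∀ w ∈ P.feasible, (B w).toLinearMap.IsSymmetric)
  (hBbdd : ∀ w ∈ P.feasible, ‖B w‖ ≤ Bhat) (hx : Tendsto x atTop (𝓝 xs))
  (hxs : xs ∈ P.feasible) (hcrit : -gradient L xs ∈ normalCone P.feasible xs)
  (hg : Tendsto (fun l => gradient L (x l)) atTop (𝓝 (gradient L xs)))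

include hBsymm hBbdd hx hg

omit h in
theorem tendsto_sweepGrad_of_tendsto_partialSweep (hmem : ∀ l, x l ∈ P.feasible) {k : Fin K}
    (hps : Tendsto (fun l => partialSweep (z l) (x l) k) atTop (𝓝 xs)) :
    Tendsto (fun l => sweepGrad L B (x l) (z l) k) atTop (𝓝 (gradient L xs k)) := by
  have h1 : Tendsto (fun l => B (x l) (partialSweep (z l) (x l) k - x l)) atTop (𝓝 0) := by
    have h2 : Tendsto (fun l => Bhat * ‖partialSweep (z l) (x l) k - x l‖) atTop (𝓝 0) := by
      simpa using (hps.sub hx).norm.const_mul Bhat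
    refine squeeze_zero_norm (fun l => ?_) h2
    exact ((B (x l)).le_opNorm _).trans
      (mul_le_mul_of_nonneg_right (hBbdd _ (hmem l)) (norm_nonneg _))
  have h3 := ((PiLp.continuous_apply 2 _ k).tendsto _).comp (hg.add h1)
  simp only [add_zero] at h3
  refine h3.congr fun l => ?_
  rw [sweepGrad_eq (hBsymm _ (hmem l))]
  rfl

include hxs hcrit

/-- All partial sweeps converge to the limit of the iterates, which every projected gradient step
fixes; the step-sizes need not be bounded away from zero for this. -/
theorem tendsto_partialSweep {j : ℕ} (hj : j ≤ K) :
    Tendsto (fun l => partialSweep (z l) (x l) j) atTop (𝓝 xs) := by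
  induction j with
  | zero => simpa [partialSweep_zero] using hx
  | succ j ih =>
    have ih := ih (by omega)
    set k : Fin K := ⟨j, hj⟩ with hk
    have hsg := tendsto_sweepGrad_of_tendsto_partialSweep (k := k) (z := z) hBsymm hBbdd hx hg
      h.mem ih
    have hxk : Tendsto (fun l => x l k) atTop (𝓝 (xs k)) :=
      ((PiLp.continuous_apply 2 _ k).tendsto _).comp hx
    have hv := (Constraints.mem_normalCone_feasible_iff hxs).1 hcrit k
    have hbound : ∀ l, ‖z l k - xs k‖ ≤
        ‖x l k - xs k‖ + q.ν₅ * ‖gradient L xs k - sweepGrad L B (x l) (z l) k‖ := by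
      intro l
      have ha := (h.cauchy l).stepSize_pos k
      have h1 : proj (P.blockSet k) (xs k + α l k • (-gradient L xs) k) = xs k :=
        proj_add_eq_of_mem_normalCone (P.isClosed_blockSet k) (P.convex_blockSet k) (hxs k)
          (smul_mem_normalCone ha.le hv)
      have h2 := norm_proj_sub_proj_le ⟨_, hxs k⟩ (P.isClosed_blockSet k) (P.convex_blockSet k)
        (x l k + α l k • (-sweepGrad L B (x l) (z l) k)) (xs k + α l k • (-gradient L xs) k)
      rw [h1, ← (h.cauchy l).eq_proj k] at h2
      refine h2.trans ?_
      have e : x l k + α l k • (-sweepGrad L B (x l) (z l) k) -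
          (xs k + α l k • (-gradient L xs) k) =
          (x l k - xs k) + α l k • (gradient L xs k - sweepGrad L B (x l) (z l) k) := by
        rw [PiLp.neg_apply]
        module
      rw [e]
      refine (norm_add_le _ _).trans ?_
      rw [norm_smul, Real.norm_of_nonneg ha.le]
      gcongr
      exact (h.cauchy l).stepSize_le k
    have hzk : Tendsto (fun l => z l k) atTop (𝓝 (xs k)) := by
      rw [tendsto_iff_norm_sub_tendsto_zero]
      refine squeeze_zero (fun l => norm_nonneg _) hbound ?_
      simpa using (hxk.sub_const (xs k)).norm.add
        ((hsg.const_sub (gradient L xs k)).norm.const_mul q.ν₅)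
    have hd : Tendsto (fun l => partialSweep (z l) (x l) (j + 1) - partialSweep (z l) (x l) j)
        atTop (𝓝 0) := by
      rw [tendsto_zero_iff_norm_tendsto_zero]
      have h3 : Tendsto (fun l => ‖z l k - x l k‖) atTop (𝓝 0) := by
        simpa using (hzk.sub hxk).norm
      refine h3.congr fun l => ?_
      have h4 := sweep_sub_sweep (z l) (x l) k (z l k) (x l k)
      rw [sweep_self_left, sweep_self_right] at h4
      rw [← PiLp.norm_single 2 (fun k => Block (n k)) k, ← h4]
    simpa using hd.add ih

theorem tendsto_cauchy : Tendsto z atTop (𝓝 xs) := by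
  have := h.tendsto_partialSweep hBsymm hBbdd hx hxs hcrit hg le_rfl
  simpa only [partialSweep_last] using this

theorem tendsto_sweepGrad (k : Fin K) :
    Tendsto (fun l => sweepGrad L B (x l) (z l) k) atTop (𝓝 (gradient L xs k)) :=
  tendsto_sweepGrad_of_tendsto_partialSweep hBsymm hBbdd hx hg h.mem
    (h.tendsto_partialSweep hBsymm hBbdd hx hxs hcrit hg k.2.le)

end IsRun

/-! ### Identification of the active constraints -/

namespace IsRun

variable {K : ℕ} {n : Fin K → ℕ} {P : Constraints n} {L : Space n → ℝ}
  {B : Space n → Space n →L[ℝ] Space n} {q : Params} {x z y : ℕ → Space n} {Δ σ : ℕ → ℝ}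
  {α : ℕ → Fin K → ℝ} (h : IsRun P L B q x z y Δ σ α)
  {xs : Space n} {k : Fin K} (hxs : xs ∈ P.feasible)
  (hx : Tendsto x atTop (𝓝 xs)) (hz : Tendsto z atTop (𝓝 xs))
  (hnd : InRelInterior (normalCone (P.blockSet k) (xs k)) (-gradient L xs k))
  (hsg : Tendsto (fun l => sweepGrad L B (x l) (z l) k) atTop (𝓝 (gradient L xs k)))

omit h in
theorem tendsto_block (k : Fin K) {w : ℕ → Space n} (hw : Tendsto w atTop (𝓝 xs)) :
    Tendsto (fun l => w l k) atTop (𝓝 (xs k)) :=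
  ((PiLp.continuous_apply 2 _ k).tendsto _).comp hw

include h in
theorem residual_mem (l : ℕ) :
    -sweepGrad L B (x l) (z l) k - (α l k)⁻¹ • (z l k - x l k) ∈
      normalCone (P.blockSet k) (z l k) := by
  have := residual_mem_normalCone (P.isClosed_blockSet k) (P.convex_blockSet k)
    (w := -sweepGrad L B (x l) (z l) k) (h.mem l k) ((h.cauchy l).stepSize_pos k)
  rwa [← (h.cauchy l).eq_proj k] at this

include h hsg in
/-- If the step in block `k` is short compared to the step-size, then its residual is close to
`-∇_k L(xs)`. -/
theorem eventually_norm_residual_sub_lt {ε : ℝ} (hε : 0 < ε) :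
    ∀ᶠ l in atTop, ‖z l k - x l k‖ < ε / 2 * α l k →
      ‖-sweepGrad L B (x l) (z l) k - (α l k)⁻¹ • (z l k - x l k) - -gradient L xs k‖ < ε := by
  filter_upwards [hsg.eventually (Metric.ball_mem_nhds _ (half_pos hε))] with l hl hstep
  have ha := (h.cauchy l).stepSize_pos k
  rw [dist_eq_norm] at hl
  have e : -sweepGrad L B (x l) (z l) k - (α l k)⁻¹ • (z l k - x l k) - -gradient L xs k =
      -(sweepGrad L B (x l) (z l) k - gradient L xs k) + -((α l k)⁻¹ • (z l k - x l k)) := by abel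
  rw [e]
  refine (norm_add_le _ _).trans_lt ?_
  rw [norm_neg, norm_neg, norm_smul, norm_inv, Real.norm_of_nonneg ha.le]
  have : (α l k)⁻¹ * ‖z l k - x l k‖ < ε / 2 := by
    rwa [inv_mul_lt_iff₀ ha, mul_comm]
  linarith

include h hxs hnd hsg

/-- Short steps relative to the step-size end on the face of `xs`. -/
theorem exists_eventually_blockActive_subset :
    ∃ ε > 0, ∀ᶠ l in atTop, ‖z l k - x l k‖ < ε * α l k →
      P.blockActive k (xs k) ⊆ P.blockActive k (z l k) := by
  obtain ⟨ε, hε, hid⟩ := Constraints.exists_blockActive_subset hnd (hxs k)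
  refine ⟨ε / 2, half_pos hε, ?_⟩
  filter_upwards [h.eventually_norm_residual_sub_lt hsg hε] with l hl hstep
  exact hid _ (h.cauchy_mem l k) _ (h.residual_mem l) (hl hstep)

/-- Once block `k` of the iterate is on the face of `xs`, so is that of the Cauchy point, no
matter how small the step-size is. -/
theorem eventually_active_cauchy_of_active :
    ∀ᶠ l in atTop, P.blockActive k (xs k) ⊆ P.blockActive k (x l k) →
      P.blockActive k (xs k) ⊆ P.blockActive k (z l k) := by
  obtain ⟨ε, hε, hid⟩ := h.exists_eventually_blockActive_subset hxs hnd hsg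
  filter_upwards [hid, hsg.eventually (Metric.ball_mem_nhds _ hε)] with l hl hgl hact
  refine hl ?_
  have ha := (h.cauchy l).stepSize_pos k
  rw [dist_eq_norm] at hgl
  have hv := Constraints.normalCone_subset_of_blockActive_subset (hxs k) hact hnd.mem_normalCone
  have h1 := proj_add_eq_of_mem_normalCone (P.isClosed_blockSet k) (P.convex_blockSet k)
    (h.mem l k) (smul_mem_normalCone ha.le hv)
  have h2 := norm_proj_sub_proj_le ⟨_, hxs k⟩ (P.isClosed_blockSet k) (P.convex_blockSet k)
    (x l k + α l k • (-sweepGrad L B (x l) (z l) k)) (x l k + α l k • (-gradient L xs k))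
  rw [h1, ← (h.cauchy l).eq_proj k, add_sub_add_left_eq_sub, ← smul_sub, norm_smul,
    Real.norm_of_nonneg ha.le, neg_sub_neg, norm_sub_rev (gradient L xs k)] at h2
  refine h2.trans_lt ?_
  rw [mul_comm]
  exact mul_lt_mul_of_pos_right hgl ha

include hz

/-- If block `k` of the Cauchy point lies on the face of `xs`, then the predicted decrease is at
least proportional to the distance of the iterate from the face, measured by
`⟨-∇_k L(xs), xs - x⟩`. -/
theorem exists_eventually_le_model_of_active :
    ∃ c > 0, ∀ᶠ l in atTop, P.blockActive k (xs k) ⊆ P.blockActive k (z l k) →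
      c * inner ℝ (-gradient L xs k) (xs k - x l k) ≤
        model L B (x l) (x l) - model L B (x l) (y l) := by
  obtain ⟨ε, hε, htwo⟩ := hnd.exists_two_smul_sub_mem
  set v := -gradient L xs k with hv
  have hν₀ := q.hν₀.1
  have hγ := q.hγ.1
  set c := min (1 / 2) (ε / 2 / (‖v‖ + 1)) with hc
  have hv1 : 0 < ‖v‖ + 1 := by positivity
  have hc0 : 0 < c := lt_min (by positivity) (by positivity)
  refine ⟨q.γ₁ * q.ν₀ * c, by positivity, ?_⟩
  filter_upwards [h.eventually_norm_residual_sub_lt hsg hε,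
    (tendsto_block k hz).eventually (Constraints.eventually_blockActive_subset (hxs k))]
    with l hl hzact hact
  have ha := (h.cauchy l).stepSize_pos k
  have hN : normalCone (P.blockSet k) (z l k) = normalCone (P.blockSet k) (xs k) :=
    Set.Subset.antisymm
      (Constraints.normalCone_subset_of_blockActive_subset (h.cauchy_mem l k) hzact)
      (Constraints.normalCone_subset_of_blockActive_subset (hxs k) hact)
  have hres := h.residual_mem (k := k) l
  refine le_trans ?_ ((h.refine l).inner_le (h.cauchy l) (h.mem l) k)
  rw [mul_assoc]
  refine mul_le_mul_of_nonneg_left ?_ (by positivity)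
  set w := -sweepGrad L B (x l) (z l) k with hw
  set s := z l k - x l k with hs
  have hnn : 0 ≤ inner ℝ v (xs k - x l k) := by
    have := hnd.mem_normalCone _ (h.mem l k)
    rw [← neg_sub, inner_neg_right] at this
    linarith
  have hvs : inner ℝ v (xs k - x l k) = inner ℝ v s := by
    have := inner_sub_eq_zero_of_mem_normalCone (hxs k) (h.cauchy_mem l k) hnd.mem_normalCone
      (hN ▸ hnd.mem_normalCone)
    have e : s = (z l k - xs k) + (xs k - x l k) := by rw [hs]; abel
    rw [e, inner_add_right, this, zero_add]
  have hsq := (h.cauchy l).norm_sq_le (h.mem l) k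
  rw [← hw, ← hs] at hsq
  rcases lt_or_ge ‖s‖ (ε / 2 * α l k) with hlt | hge
  · -- the residual `u` dominates `v / 2`, and it contributes `⟨u, z - x⟩` to the decrease
    have hu := htwo _ (hN ▸ hres) (hl hlt)
    rw [← hN] at hu
    have h1 := hu _ (h.mem l k)
    rw [← neg_sub (z l k), ← hs, inner_neg_right, inner_sub_left, real_inner_smul_left,
      inner_sub_left, real_inner_smul_left, real_inner_self_eq_norm_sq] at h1
    have h2 : 0 ≤ (α l k)⁻¹ * ‖s‖ ^ 2 := by positivity
    have h3 : c * inner ℝ v (xs k - x l k) ≤ 1 / 2 * inner ℝ v (xs k - x l k) :=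
      mul_le_mul_of_nonneg_right (min_le_left _ _) hnn
    linarith
  · have h1 : ε / 2 * ‖s‖ ≤ inner ℝ w s := by
      have h2 := mul_le_mul_of_nonneg_right hge (norm_nonneg s)
      have h3 : α l k * (ε / 2 * ‖s‖) ≤ α l k * inner ℝ w s := by linarith
      exact le_of_mul_le_mul_left h3 ha
    refine le_trans ?_ h1
    calc c * inner ℝ v (xs k - x l k)
        ≤ ε / 2 / (‖v‖ + 1) * inner ℝ v (xs k - x l k) :=
          mul_le_mul_of_nonneg_right (min_le_right _ _) hnn
      _ ≤ ε / 2 / (‖v‖ + 1) * ((‖v‖ + 1) * ‖s‖) := by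
          refine mul_le_mul_of_nonneg_left ?_ (by positivity)
          rw [hvs]
          exact (real_inner_le_norm _ _).trans
            (mul_le_mul_of_nonneg_right (by linarith) (norm_nonneg _))
      _ = ε / 2 * ‖s‖ := by field_simp

include hx

/-- If block `k` of the Cauchy point misses the face of `xs`, then the step-size is small, hence
it was limited by the trust region: the step in block `k` is at least proportional to the radius,
and so are the predicted decrease and the distance from the face, measured by
`⟨-∇_k L(xs), xs - x⟩`. -/
theorem exists_eventually_radius_le_of_not_active {Bhat : ℝ}
    (hBsymm : ∀ w ∈ P.feasible, (B w).toLinearMap.IsSymmetric)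
    (hBbdd : ∀ w ∈ P.feasible, ‖B w‖ ≤ Bhat) :
    ∃ c > 0, ∀ᶠ l in atTop, ¬ P.blockActive k (xs k) ⊆ P.blockActive k (z l k) →
      c * Δ l ≤ model L B (x l) (x l) - model L B (x l) (y l) ∧
      c * Δ l ≤ inner ℝ (-gradient L xs k) (xs k - x l k) := by
  obtain ⟨ε, hε, hid⟩ := h.exists_eventually_blockActive_subset hxs hnd hsg
  have hB0 : 0 ≤ Bhat := (norm_nonneg _).trans (hBbdd _ hxs)
  have hν₀ := q.hν₀.1
  have hν₃ := q.hν.1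
  have hν₁ := q.hν₁₂.1
  have hγ := q.hγ.1
  -- below `τ` a step-size is less than `ν₄`, and step-sizes up to `τ / ν₃` give sufficient
  -- decrease
  set τ := min q.ν₄ (q.ν₃ * (2 * (1 - q.ν₀) / (Bhat + 1))) with hτ
  have hB1 : 0 < 2 * (1 - q.ν₀) / (Bhat + 1) :=
    div_pos (by linarith [q.hν₀.2]) (by linarith)
  have hτ0 : 0 < τ := lt_min q.hν.2.1 (mul_pos q.hν.1 hB1)
  set M := 1 + q.ν₃⁻¹ with hM
  have hM0 : 0 < M := by positivity
  set c := min (q.γ₁ * q.ν₀ * ε) (ε / 2) with hc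
  have hc0 : 0 < c := lt_min (by positivity) (by positivity)
  have hzx : Tendsto (fun l => ‖z l k - x l k‖) atTop (𝓝 0) := by
    simpa using ((tendsto_block k hz).sub (tendsto_block k hx)).norm
  refine ⟨c * (q.ν₁ / M), by positivity, ?_⟩
  filter_upwards [hid, hsg.eventually (Metric.ball_mem_nhds _ (half_pos hε)),
    hzx.eventually_lt_const (mul_pos hε hτ0)] with l hl hgl hsmall hna
  have ha := (h.cauchy l).stepSize_pos k
  rw [dist_eq_norm] at hgl
  set w := -sweepGrad L B (x l) (z l) k with hw
  set s := z l k - x l k with hs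
  have hlong : ε * α l k ≤ ‖s‖ := not_lt.1 fun hlt => hna (hl hlt)
  have hατ : α l k < τ := lt_of_mul_lt_mul_left (hlong.trans_lt hsmall) hε.le
  -- the trust region was active for a step-size comparable to `α l k`
  have hΔ : q.ν₁ * Δ l ≤ M * ‖s‖ := by
    rcases (h.cauchy l k).2.2.2 with hα | ⟨a, ha0, hα, hα'⟩
    · exact absurd hα.1 (not_le.2 (hατ.trans_le (min_le_left _ _)))
    · have haB : a < 2 * (1 - q.ν₀) / (Bhat + 1) :=
        lt_of_mul_lt_mul_left (hα.1.trans_lt (hατ.trans_le (min_le_right _ _))) hν₃.le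
      rcases hα' with hns | hbd
      · refine absurd (sufficientDecrease_trialBlock (hBsymm _ (h.mem l)) (h.mem l) ha0 ?_) hns
        rw [lt_div_iff₀ (by linarith)] at haB
        have := mul_le_mul_of_nonneg_left (hBbdd _ (h.mem l)) ha0.le
        linarith
      · refine (hbd.trans (blockSupNorm_le_norm _)).trans ?_
        rw [trialBlock_eq]
        have hs' : proj (P.blockSet k) (x l k + α l k • w) - x l k = s := by
          rw [hs, hw, ← (h.cauchy l).eq_proj k]
        rcases norm_proj_step_le_or (P.isClosed_blockSet k) (P.convex_blockSet k) (h.mem l k) w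
          ha0 ha with h1 | h1
        · rw [hs'] at h1
          refine h1.trans (le_mul_of_one_le_left (norm_nonneg _) ?_)
          rw [hM]
          linarith [inv_pos.2 hν₃]
        · rw [hs'] at h1
          have h2 : a ≤ q.ν₃⁻¹ * α l k := by
            rw [le_inv_mul_iff₀ hν₃]
            exact hα.1
          have h3 := mul_le_mul_of_nonneg_right h2 (norm_nonneg s)
          have h4 : α l k * ‖proj (P.blockSet k) (x l k + a • w) - x l k‖ ≤
              α l k * (q.ν₃⁻¹ * ‖s‖) := by linarith
          refine (le_of_mul_le_mul_left h4 ha).trans ?_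
          gcongr
          rw [hM]
          linarith
  have hinner : ε * ‖s‖ ≤ inner ℝ w s := by
    have h1 := (h.cauchy l).norm_sq_le (h.mem l) k
    have h2 := mul_le_mul_of_nonneg_right hlong (norm_nonneg s)
    have h3 : α l k * (ε * ‖s‖) ≤ α l k * inner ℝ w s := by linarith
    exact le_of_mul_le_mul_left h3 ha
  have hcΔ : c * (q.ν₁ / M) * Δ l ≤ c * ‖s‖ := by
    rw [mul_assoc]
    gcongr
    rw [div_mul_eq_mul_div, div_le_iff₀ hM0, mul_comm ‖s‖]
    exact hΔ
  refine ⟨hcΔ.trans ?_, hcΔ.trans ?_⟩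
  · refine le_trans ?_ ((h.refine l).inner_le (h.cauchy l) (h.mem l) k)
    calc c * ‖s‖ ≤ q.γ₁ * q.ν₀ * ε * ‖s‖ := by gcongr; exact min_le_left _ _
      _ = q.γ₁ * q.ν₀ * (ε * ‖s‖) := by ring
      _ ≤ q.γ₁ * q.ν₀ * inner ℝ w s := by gcongr
  · have h1 := hnd.mem_normalCone _ (h.cauchy_mem l k)
    have e : z l k - xs k = s - (xs k - x l k) := by rw [hs]; abel
    rw [e, inner_sub_right] at h1
    have h2 : inner ℝ w s - ε / 2 * ‖s‖ ≤ inner ℝ (-gradient L xs k) s := by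
      have h3 := real_inner_le_norm (w - -gradient L xs k) s
      have h4 : ‖w - -gradient L xs k‖ ≤ ε / 2 := by
        rw [hw, neg_sub_neg, norm_sub_rev]
        exact hgl.le
      have h5 := mul_le_mul_of_nonneg_right h4 (norm_nonneg s)
      rw [inner_sub_left] at h3
      linarith
    have h6 : c * ‖s‖ ≤ ε / 2 * ‖s‖ := by gcongr; exact min_le_right _ _
    linarith

omit hxs hx hz hnd hsg in
/-- For vanishing radii the model error is negligible compared to the radius. -/
theorem eventually_abs_sub_model_le {Bhat : ℝ} (hBbdd : ∀ w ∈ P.feasible, ‖B w‖ ≤ Bhat)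
    (hdiff : ∀ w ∈ P.feasible, DifferentiableAt ℝ L w)
    (hgrad : UniformContinuousOn (gradient L) P.feasible) (hΔ : Tendsto Δ atTop (𝓝 0))
    {ε : ℝ} (hε : 0 < ε) :
    ∀ᶠ l in atTop, |L (y l) - model L B (x l) (y l)| ≤ ε * Δ l := by
  have hB0 : 0 ≤ Bhat := (norm_nonneg _).trans (hBbdd _ (h.mem 0))
  set C := (∑ k, (n k : ℝ)) * q.γ₂ with hC
  have hC0 : 0 ≤ C := mul_nonneg (Finset.sum_nonneg fun _ _ => Nat.cast_nonneg _) q.hγ.2.2.le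
  set ε' := ε / 2 / (C + 1) with hε'
  have hε'0 : 0 < ε' := by positivity
  obtain ⟨r, hr, htaylor⟩ :=
    exists_abs_sub_sub_inner_gradient_le P.convex_feasible hdiff hgrad hε'0
  have h1 : Tendsto (fun l => C * Δ l) atTop (𝓝 0) := by simpa using hΔ.const_mul C
  have h2 : Tendsto (fun l => Bhat * (C * (C * Δ l))) atTop (𝓝 0) := by
    simpa using (h1.const_mul C).const_mul Bhat
  filter_upwards [h1.eventually_lt_const hr, h2.eventually_lt_const hε] with l hl1 hl2
  have hΔl := h.radius_pos l
  have hyx := (h.refine l).norm_le_radius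
  rw [← hC] at hyx
  have h3 := htaylor _ (h.mem l) _ (h.refine l).1 (hyx.trans_lt hl1)
  set s := y l - x l with hs
  have h4 : |inner ℝ s (B (x l) s)| ≤ Bhat * ‖s‖ ^ 2 := by
    refine (abs_real_inner_le_norm _ _).trans ?_
    have h5 := ((B (x l)).le_opNorm s).trans
      (mul_le_mul_of_nonneg_right (hBbdd _ (h.mem l)) (norm_nonneg s))
    have h6 := mul_le_mul_of_nonneg_left h5 (norm_nonneg s)
    linarith
  have e : L (y l) - model L B (x l) (y l) =
      (L (y l) - L (x l) - inner ℝ (gradient L (x l)) s) - 1 / 2 * inner ℝ s (B (x l) s) := by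
    rw [model, hs]; ring
  rw [e]
  refine (abs_sub _ _).trans ?_
  rw [abs_mul, abs_of_nonneg (by norm_num : (0 : ℝ) ≤ 1 / 2)]
  have h7 : ε' * ‖s‖ ≤ ε / 2 * Δ l := by
    calc ε' * ‖s‖ ≤ ε' * ((C + 1) * Δ l) := by gcongr; linarith
      _ = ε / 2 * Δ l := by rw [hε']; field_simp
  have h8 : Bhat * ‖s‖ ^ 2 ≤ ε * Δ l := by
    calc Bhat * ‖s‖ ^ 2 ≤ Bhat * (C * Δ l) ^ 2 := by gcongr
      _ = Bhat * (C * (C * Δ l)) * Δ l := by ring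
      _ ≤ ε * Δ l := by gcongr
  linarith

omit hxs hx hz hnd hsg in
/-- If accepted steps decrease the objective proportionally to the radius, the radii vanish. -/
theorem tendsto_radius {b c : ℝ} (hc : 0 < c) (hL : Tendsto (fun l => L (x l)) atTop (𝓝 b))
    {l₀ : ℕ} (hacc : ∀ l ≥ l₀, Δ (l + 1) ≤ q.σ₂ * Δ l ∨ c * Δ (l + 1) ≤ L (x l) - L (x (l + 1))) :
    Tendsto Δ atTop (𝓝 0) := by
  have hrec : ∀ l ≥ l₀, c * Δ (l + 1) ≤ q.σ₂ * (c * Δ l) + (L (x l) - L (x (l + 1))) := by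
    intro l hl
    have h1 : 0 ≤ L (x l) - L (x (l + 1)) := sub_nonneg.2 (h.antitone (Nat.le_succ l))
    have h2 : 0 ≤ q.σ₂ * (c * Δ l) :=
      mul_nonneg (q.hσ.1.trans q.hσ.2.1).le (mul_nonneg hc.le (h.radius_pos l).le)
    rcases hacc l hl with h3 | h3
    · have := mul_le_mul_of_nonneg_left h3 hc.le
      linarith
    · linarith
  -- `S` is a decreasing potential that drops by at least `c (1 - σ₂) Δ`
  set S : ℕ → ℝ := fun l => c * Δ (l + l₀) + L (x (l + l₀)) with hS
  have hdrop : ∀ l, c * (1 - q.σ₂) * Δ (l + l₀) ≤ S l - S (l + 1) := by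
    intro l
    have := hrec (l + l₀) (Nat.le_add_left _ _)
    have e : l + 1 + l₀ = l + l₀ + 1 := by omega
    simp only [hS, e]
    linarith
  have hσ : 0 < 1 - q.σ₂ := by linarith [q.hσ.2.2.1]
  have hanti : Antitone S := antitone_nat_of_succ_le fun l => by
    have h1 := hdrop l
    have h2 : 0 ≤ c * (1 - q.σ₂) * Δ (l + l₀) := by
      have := h.radius_pos (l + l₀); positivity
    linarith
  have hb : BddBelow (Set.range S) := ⟨b, by
    rintro _ ⟨l, rfl⟩
    have h1 : b ≤ L (x (l + l₀)) := h.antitone.le_of_tendsto hL _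
    have h2 : 0 ≤ c * Δ (l + l₀) := mul_nonneg hc.le (h.radius_pos _).le
    simp only [hS]
    linarith⟩
  have hlim := tendsto_atTop_ciInf hanti hb
  have hdiff : Tendsto (fun l => S l - S (l + 1)) atTop (𝓝 0) := by
    simpa using hlim.sub (hlim.comp (tendsto_add_atTop_nat 1))
  refine (tendsto_add_atTop_iff_nat l₀).1 ?_
  have hC : 0 < c * (1 - q.σ₂) := by positivity
  refine squeeze_zero (fun l => (h.radius_pos _).le) (fun l => ?_)
    (by simpa using hdiff.div_const (c * (1 - q.σ₂)))
  rw [le_div_iff₀ hC, mul_comm]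
  exact hdrop l

/-- Block `k` of the iterates reaches the face of `xs`. Otherwise every accepted step would start
from a Cauchy point that misses the face, so that the radii would vanish; for small radii such
Cauchy points give very successful steps, and rejected steps leave the radius so large compared to
the distance from the face that all later Cauchy points hit the face and are rejected as well. -/
theorem frequently_active {Bhat : ℝ}
    (hBsymm : ∀ w ∈ P.feasible, (B w).toLinearMap.IsSymmetric)
    (hBbdd : ∀ w ∈ P.feasible, ‖B w‖ ≤ Bhat)
    (hdiff : ∀ w ∈ P.feasible, DifferentiableAt ℝ L w)
    (hgrad : UniformContinuousOn (gradient L) P.feasible) :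
    ∃ᶠ l in atTop, P.blockActive k (xs k) ⊆ P.blockActive k (x l k) := by
  by_contra hcon
  rw [not_frequently] at hcon
  obtain ⟨c₁, hc₁, hmiss⟩ :=
    h.exists_eventually_radius_le_of_not_active hxs hx hz hnd hsg hBsymm hBbdd
  obtain ⟨c₂, hc₂, hhit⟩ := h.exists_eventually_le_model_of_active hxs hz hnd hsg
  have hL : Tendsto (fun l => L (x l)) atTop (𝓝 (L xs)) :=
    (hdiff xs hxs).continuousAt.tendsto.comp hx
  -- a Cauchy point on the face is rejected, as the refinement keeps the face
  have hrej : ∀ᶠ l in atTop, P.blockActive k (xs k) ⊆ P.blockActive k (z l k) →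
      ratio L B (x l) (y l) < q.η₁ ∧ x (l + 1) = x l ∧
        q.σ₁ * Δ l ≤ Δ (l + 1) ∧ Δ (l + 1) ≤ q.σ₂ * Δ l := by
    filter_upwards [(tendsto_add_atTop_nat 1).eventually hcon] with l hl hact
    rcases h.fail_or_accept l with hfail | ⟨h1, -⟩
    · exact hfail
    · refine absurd ?_ hl
      rw [h1]
      exact hact.trans ((h.refine l).2.2.2.1 k)
  have hη₁ := q.hη.1
  have hη : 0 < 1 - q.η₂ := by linarith [q.hη.2.2]
  have hσ₁ := q.hσ.1
  have hσ₃ : 0 < q.σ₃ := one_pos.trans q.hσ.2.2.2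
  have hΔ : Tendsto Δ atTop (𝓝 0) := by
    obtain ⟨l₀, hl₀⟩ := eventually_atTop.1 (hmiss.and hrej)
    refine h.tendsto_radius (c := q.η₁ * c₁ / q.σ₃) (by positivity) hL (l₀ := l₀) fun l hl => ?_
    by_cases hact : P.blockActive k (xs k) ⊆ P.blockActive k (z l k)
    · exact Or.inl ((hl₀ l hl).2 hact).2.2.2
    rcases h.fail_or_accept l with ⟨-, -, -, h1⟩ | ⟨-, h2, -, h3⟩
    · exact Or.inl h1
    · right
      have h4 := ((hl₀ l hl).1 hact).1
      calc q.η₁ * c₁ / q.σ₃ * Δ (l + 1) ≤ q.η₁ * c₁ / q.σ₃ * (q.σ₃ * Δ l) := by gcongr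
        _ = q.η₁ * (c₁ * Δ l) := by field_simp
        _ ≤ q.η₁ * (model L B (x l) (x l) - model L B (x l) (y l)) := by gcongr
        _ ≤ L (x l) - L (x (l + 1)) := h2
  -- the error constant makes missing steps very successful, and makes the radius after a
  -- rejected hit too large for a miss
  set ε := min ((1 - q.η₂) * c₁ / 2) ((1 - q.η₂) * c₂ * (c₁ * q.σ₁ / 2)) with hε
  have hε0 : 0 < ε := lt_min (by positivity) (by positivity)
  have herr := h.eventually_abs_sub_model_le hBbdd hdiff hgrad hΔ hε0
  obtain ⟨l₀, hl₀⟩ := eventually_atTop.1 (hmiss.and (hhit.and (hrej.and (herr.and hcon))))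
  by_cases hall : ∃ l ≥ l₀, P.blockActive k (xs k) ⊆ P.blockActive k (z l k)
  · obtain ⟨l₁, hl₁, hact₁⟩ := hall
    have hstay : ∀ l ≥ l₁, P.blockActive k (xs k) ⊆ P.blockActive k (z l k) ∧ x l = x l₁ := by
      intro l hl
      induction l, hl using Nat.le_induction with
      | base => exact ⟨hact₁, rfl⟩
      | succ l hl ih =>
        obtain ⟨-, h2, h3, h4, -⟩ := hl₀ l (hl₁.trans hl)
        obtain ⟨hr, hxl, hΔl, -⟩ := h3 ih.1
        refine ⟨?_, hxl.trans ih.2⟩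
        by_contra hna
        have h5 := ((hl₀ (l + 1) (by omega)).1 hna).2
        rw [hxl] at h5
        have h6 := h2 ih.1
        have h7 : (1 - q.η₂) * (model L B (x l) (x l) - model L B (x l) (y l)) ≤ ε * Δ l := by
          by_contra! hlt
          have := lt_ratio_of_abs_sub_lt (h4.trans_lt hlt)
          linarith [q.hη.2.1]
        have hpos := h.radius_pos l
        have h8 : ε * Δ l ≤ (1 - q.η₂) * c₂ * (c₁ * q.σ₁ / 2) * Δ l := by
          gcongr; exact min_le_right _ _
        have h9 : (1 - q.η₂) * c₂ * inner ℝ (-gradient L xs k) (xs k - x l k) ≤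
            (1 - q.η₂) * c₂ * (c₁ * q.σ₁ / 2 * Δ l) := by
          have := mul_le_mul_of_nonneg_left h6 hη.le
          linarith
        have h10 := le_of_mul_le_mul_left h9 (by positivity)
        have h11 : c₁ * (q.σ₁ * Δ l) ≤ c₁ * Δ (l + 1) := by gcongr
        have h12 : 0 < c₁ * q.σ₁ * Δ l := by positivity
        linarith
    -- the iterates are constant from `l₁` on, hence equal to `xs`
    have hconst : x l₁ = xs := by
      refine tendsto_nhds_unique (tendsto_const_nhds.congr' ?_) hx
      filter_upwards [eventually_ge_atTop l₁] with l hl using ((hstay l hl).2).symm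
    exact (hl₀ l₁ hl₁).2.2.2.2 (by rw [hconst])
  · push Not at hall
    have hmono : ∀ l ≥ l₀, Δ l₀ ≤ Δ l := by
      intro l hl
      induction l, hl using Nat.le_induction with
      | base => exact le_rfl
      | succ l hl ih =>
        obtain ⟨h1, -, -, h4, -⟩ := hl₀ l hl
        have h5 := (h1 (hall l hl)).1
        have hpos := h.radius_pos l
        have h6 : q.η₂ < ratio L B (x l) (y l) := by
          refine lt_ratio_of_abs_sub_lt (h4.trans_lt ?_)
          have h7 : ε * Δ l ≤ (1 - q.η₂) * c₁ / 2 * Δ l := by gcongr; exact min_le_left _ _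
          have h8 := mul_le_mul_of_nonneg_left h5 hη.le
          have h9 : 0 < (1 - q.η₂) * c₁ * Δ l := by positivity
          linarith
        exact ih.trans ((h.update l).2.2 h6).2.1
    have := ge_of_tendsto hΔ (eventually_atTop.2 ⟨l₀, hmono⟩)
    exact absurd (h.radius_pos l₀) (not_lt.2 this)

/-- Block `k` of the iterates and of the Cauchy points eventually has the active set of `xs`:
once an iterate is on the face, the Cauchy point and hence the refined point are, too. -/
theorem eventually_blockActive_eq {Bhat : ℝ}
    (hBsymm : ∀ w ∈ P.feasible, (B w).toLinearMap.IsSymmetric)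
    (hBbdd : ∀ w ∈ P.feasible, ‖B w‖ ≤ Bhat)
    (hdiff : ∀ w ∈ P.feasible, DifferentiableAt ℝ L w)
    (hgrad : UniformContinuousOn (gradient L) P.feasible) :
    ∀ᶠ l in atTop, P.blockActive k (x l k) = P.blockActive k (xs k) ∧
      P.blockActive k (z l k) = P.blockActive k (xs k) := by
  obtain ⟨l₀, hl₀⟩ := eventually_atTop.1 (h.eventually_active_cauchy_of_active hxs hnd hsg)
  obtain ⟨l₁, hl₁, hact⟩ := frequently_atTop.1
    (h.frequently_active hxs hx hz hnd hsg hBsymm hBbdd hdiff hgrad) l₀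
  have hstay : ∀ l ≥ l₁, P.blockActive k (xs k) ⊆ P.blockActive k (x l k) := by
    intro l hl
    induction l, hl using Nat.le_induction with
    | base => exact hact
    | succ l hl ih =>
      rcases h.fail_or_accept l with ⟨-, h1, -⟩ | ⟨h1, -⟩
      · rwa [h1]
      · rw [h1]
        exact (hl₀ l (hl₁.trans hl) ih).trans ((h.refine l).2.2.2.1 k)
  have hnear := Constraints.eventually_blockActive_subset (P := P) (hxs k)
  filter_upwards [eventually_ge_atTop l₁, (tendsto_block k hx).eventually hnear,
    (tendsto_block k hz).eventually hnear] with l hl h1 h2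
  exact ⟨h1.antisymm (hstay l hl), h2.antisymm (hl₀ l (hl₁.trans hl) (hstay l hl))⟩

end IsRun

end TRAP

theorem mainTheorem3 {K : ℕ} {n : Fin K → ℕ} (P : TRAP.Constraints n)
    (L : TRAP.Space n → ℝ) (B : TRAP.Space n → TRAP.Space n →L[ℝ] TRAP.Space n)
    (q : TRAP.Params) (x z y : ℕ → TRAP.Space n) (Δ σ : ℕ → ℝ) (α : ℕ → Fin K → ℝ)
    (hrun : TRAP.IsRun P L B q x z y Δ σ α)
    -- `L` is bounded below on the part of its initial sublevel set in `Ω`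
    (hbdd : BddBelow (L '' {w | w ∈ P.feasible ∧ L w ≤ L (x 0)}))
    -- `L` is `C¹` near `Ω`, with uniformly continuous gradient
    (U : Set (TRAP.Space n)) (hU : IsOpen U) (hΩU : P.feasible ⊆ U)
    (hL : ContDiffOn ℝ 1 L U) (hgrad : UniformContinuousOn (gradient L) P.feasible)
    -- the model Hessians are symmetric and uniformly bounded
    (hBsymm : ∀ w ∈ P.feasible, (B w).toLinearMap.IsSymmetric)
    (hBbdd : ∃ Bhat : ℝ, 0 < Bhat ∧ ∀ w ∈ P.feasible, ‖B w‖ ≤ Bhat)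
    -- `xs` is a non-degenerate limit point satisfying the strong second-order condition
    (xs : TRAP.Space n) (hlim : MapClusterPt xs atTop x)
    (hnd : TRAP.NonDegenerate P.feasible L xs)
    (κ : ℝ) (hκ : 0 < κ) (hssoc : TRAP.StrongSecondOrder P.feasible L xs κ) :
    Tendsto (fun l => ‖TRAP.projGrad P.feasible L (x l)‖) atTop (𝓝 0) ∧
      ∃ l₀ : ℕ, ∀ l ≥ l₀, P.active (x l) = P.active xs ∧ P.active (z l) = P.active xs := by
  obtain ⟨Bhat, -, hB⟩ := hBbdd
  have hdiff : ∀ w ∈ P.feasible, DifferentiableAt ℝ L w := fun w hw =>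
    (hL.differentiableOn one_ne_zero).differentiableAt (hU.mem_nhds (hΩU hw))
  have hri := TRAP.inRelInterior_of_mem_intrinsicInterior hnd
  have hxs := hrun.limit_mem hlim
  have hcrit := hri.mem_normalCone
  have hx := hrun.tendsto_iterates hbdd hdiff hlim hri hκ hssoc
  have hg : Tendsto (fun l => gradient L (x l)) atTop (𝓝 (gradient L xs)) :=
    hssoc.1.continuousAt.tendsto.comp hx
  have hz := hrun.tendsto_cauchy hBsymm hB hx hxs hcrit hg
  have hid : ∀ᶠ l in atTop, ∀ k, P.blockActive k (x l k) = P.blockActive k (xs k) ∧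
      P.blockActive k (z l k) = P.blockActive k (xs k) :=
    eventually_all.2 fun k => hrun.eventually_blockActive_eq hxs hx hz
      (TRAP.Constraints.inRelInterior_block hxs hri k)
      (hrun.tendsto_sweepGrad hBsymm hB hx hxs hcrit hg k) hBsymm hB hdiff hgrad
  refine ⟨?_, ?_⟩
  · -- on the face of `xs`, the vector `-∇L(xs)` is normal at `x l`
    have h0 : Tendsto (fun l => ‖-gradient L (x l) - -gradient L xs‖) atTop (𝓝 0) := by
      simpa using (hg.neg.sub_const (-gradient L xs)).norm
    refine squeeze_zero' (Eventually.of_forall fun _ => norm_nonneg _) ?_ h0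
    filter_upwards [hid] with l hl
    refine TRAP.norm_projGrad_le P.convex_feasible (hrun.mem l) ?_ L
    rw [TRAP.Constraints.mem_normalCone_feasible_iff (hrun.mem l)]
    exact fun k => TRAP.Constraints.normalCone_subset_of_blockActive_subset (hxs k) (hl k).1.ge
      ((TRAP.Constraints.mem_normalCone_feasible_iff hxs).1 hcrit k)
  · obtain ⟨l₀, hl₀⟩ := eventually_atTop.1 hid
    refine ⟨l₀, fun l hl => ⟨?_, ?_⟩⟩
    · ext ⟨k, i⟩
      exact Set.ext_iff.1 (hl₀ l hl k).1 i
    · ext ⟨k, i⟩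
      exact Set.ext_iff.1 (hl₀ l hl k).2 i
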